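/- **Theorem.** A compatible Lie algebra is a complex vector space $L$ with two bilinear multiplications $[-,-]$ and $\{-,-\}$, each of which is a Lie bracket, such that for all $x,y,z\in L$ $$\{[x,y],z\}+\{[y,z],x\}+\{[z,x],y\}+[\{x,y\},z]+[\{y,z\},x]+[\{z,x\},y]=0 .$$ It is nilpotent if $L^{(m)}=0$ for some $m\ge 2$, where $L^{(1)}=L$ and $L^{(n)}=\sum_{i+j=n,\ i,j\ge1}\big([L^{(i)},L^{(j)}]+\{L^{(i)},L^{(j)}\}\big)$ for $n\ge2$. Let $\mathcal V$ be the set of all pairs of bilinear multiplications on $\mathbb C^4$ that make it a nilpotent compatible Lie algebra, regarded via structure constants as a subset of the affine space $\mathbb C^{128}$ with its Zariski topology. Let $\mathrm{GL}_4(\mathbb C)$ act on pairs by $(g*\mu)(x,y)=g\,\mu(g^{-1}x,g^{-1}y)$ in both multiplications, and let $O(\mu)$ denote the orbit of the pair $\mu$. For $\alpha\in\mathbb C$ let $L_{10}^{\alpha}$ be the algebra with basis $e_1,\dots,e_4$ and $$[e_1,e_2]=e_3,\quad [e_2,e_3]=e_4,\quad \{e_1,e_2\}=\alpha e_3,\quad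 \{e_1,e_3\}=e_4$$ (here and below, products of basis vectors that are zero or follow by anticommutativity are omitted). Then: 1. $\mathcal V$ is irreducible, and $\mathcal V=\overline{\bigcup_{\alpha\in\mathbb C}O(L_{10}^{\alpha})}$ (Zariski closure); 2. $\dim\mathcal V=13$; 3. the family $(L_{10}^{\alpha})_{\alpha\in\mathbb C}$ degenerates to each of the following algebras, for all $\alpha,\beta\in\mathbb C$, that is, each of them lies in $\overline{\bigcup_{\gamma\in\mathbb C}O(L_{10}^{\gamma})}$: - $L_{01}$: $\{e_1,e_2\}=e_3$; - $L_{02}^{\alpha}$: $[e_1,e_2]=e_3,\ \{e_1,e_2\}=\alpha e_3$; - $L_{03}$: $[e_2,e_3]=e_4,\ \{e_1,e_3\}=e_4$; - $L_{04}$: $[e_1,e_2]=e_3,\ [e_2,e_3]=e_4,\ \{e_1,e_2\}=e_4$; - $L_{05}^{\alpha}$: $[e_2,e_3]=\alpha e_4,\ \{e_1,e_2\}=e_3,\ \{e_2,e_3\}=e_4$; - $L_{06}$: $[e_1,e_3]=e_4,\ \{e_1,e_2\}=e_3,\ \{e_2,e_3\}=e_4$; - $L_{07}$: $[e_1,e_2]=e_4,\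 \{e_1,e_2\}=e_3,\ \{e_2,e_3\}=e_4$; - $L_{08}^{\alpha}$: $[e_1,e_2]=e_3,\ \{e_1,e_2\}=\alpha e_3,\ \{e_2,e_3\}=e_4$; - $L_{09}^{\alpha,\beta}$: $[e_1,e_2]=e_3,\ [e_2,e_3]=e_4,\ \{e_1,e_2\}=\alpha e_3,\ \{e_2,e_3\}=\beta e_4$. -/

import Mathlib

noncomputable section

namespace CompatLie

/-! ### Affine space with the Zariski topology -/

/-- The complex affine space with coordinates indexed by `σ`. It is a synonym of `σ → ℂ`, so that it
carries the Zariski topology and not the product topology. -/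
def ZariskiSpace (σ : Type) : Type := σ → ℂ

/-- The Zariski topology: the closed sets are the zero loci of ideals of polynomials. -/
instance (σ : Type) : TopologicalSpace (ZariskiSpace σ) :=
  TopologicalSpace.ofClosed
    {Z : Set (σ → ℂ) | ∃ I : Ideal (MvPolynomial σ ℂ), MvPolynomial.zeroLocus ℂ I = Z}
    ⟨⊤, MvPolynomial.zeroLocus_top⟩
    (by
      intro A hA
      have hA' : ∀ Z : Set (σ → ℂ), Z ∈ A →
          ∃ I : Ideal (MvPolynomial σ ℂ), MvPolynomial.zeroLocus ℂ I = Z := fun Z hZ => hA hZ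
      choose! I hI using hA'
      refine ⟨⨆ Z ∈ A, I Z, ?_⟩
      apply Set.eq_of_subset_of_subset
      · intro x hx Z hZ
        rw [← hI Z hZ]
        exact MvPolynomial.zeroLocus_anti_mono (le_iSup₂_of_le Z hZ le_rfl) hx
      · intro x hx
        have hle : (⨆ Z ∈ A, I Z) ≤ MvPolynomial.vanishingIdeal ℂ ({x} : Set (σ → ℂ)) := by
          refine iSup₂_le fun Z hZ => ?_
          rw [← MvPolynomial.le_zeroLocus_iff_le_vanishingIdeal, hI Z hZ]
          exact Set.singleton_subset_iff.2 (hx Z hZ)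
        exact MvPolynomial.le_zeroLocus_iff_le_vanishingIdeal.2 hle (Set.mem_singleton x))
    (by
      rintro _ ⟨I, rfl⟩ _ ⟨J, rfl⟩
      refine ⟨I * J, Set.ext fun x => ?_⟩
      constructor
      · intro hx
        by_contra hcon
        have h₁ : ¬ ∀ p ∈ I, MvPolynomial.aeval x p = 0 := fun h => hcon (Or.inl h)
        have h₂ : ¬ ∀ q ∈ J, MvPolynomial.aeval x q = 0 := fun h => hcon (Or.inr h)
        push Not at h₁ h₂
        obtain ⟨p, hp, hpx⟩ := h₁
        obtain ⟨q, hq, hqx⟩ := h₂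
        have := MvPolynomial.mem_zeroLocus_iff.1 hx (p * q) (Ideal.mul_mem_mul hp hq)
        rw [map_mul] at this
        exact (mul_ne_zero hpx hqx) this
      · rintro (hx | hx)
        · exact MvPolynomial.zeroLocus_anti_mono Ideal.mul_le_left hx
        · exact MvPolynomial.zeroLocus_anti_mono Ideal.mul_le_right hx)

/-! ### Nilpotent compatible Lie algebras -/

section Algebras

variable {V : Type} [AddCommGroup V] [Module ℂ V]

/-- `V` with the bilinear multiplications `f = [-,-]` and `g = {-,-}` is a compatible Lie algebra. -/
structure IsCompatibleLie (f g : V →ₗ[ℂ] V →ₗ[ℂ] V) : Prop where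
  alt_left : ∀ x, f x x = 0
  alt_right : ∀ x, g x x = 0
  jacobi_left : ∀ x y z, f (f x y) z + f (f y z) x + f (f z x) y = 0
  jacobi_right : ∀ x y z, g (g x y) z + g (g y z) x + g (g z x) y = 0
  compat : ∀ x y z, g (f x y) z + g (f y z) x + g (f z x) y
    + f (g x y) z + f (g y z) x + f (g z x) y = 0

/-- The powers of an algebra with two multiplications: the first power is the whole algebra, and for
`n ≥ 2` the `n`-th power is the sum of the spans of all products, under either multiplication, of
the `i`-th with the `j`-th power, where `i, j ≥ 1` and `i + j = n`. (Index `0` is not used.) -/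
def power (f g : V →ₗ[ℂ] V →ₗ[ℂ] V) : ℕ → Submodule ℂ V
  | 0 => ⊤
  | 1 => ⊤
  | n + 2 => ⨆ i : Fin (n + 1),
      Submodule.map₂ f (power f g (i + 1)) (power f g (n + 1 - i)) ⊔
        Submodule.map₂ g (power f g (i + 1)) (power f g (n + 1 - i))
  termination_by n => n
  decreasing_by all_goals (have := i.2; omega)

/-- Nilpotency of an algebra with two multiplications: some power vanishes. -/
def IsNilpotentPair (f g : V →ₗ[ℂ] V →ₗ[ℂ] V) : Prop :=
  ∃ m, 2 ≤ m ∧ power f g m = ⊥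

end Algebras

/-! ### Structure constants, the variety, orbits and degenerations -/

/-- The affine space of structure constants of pairs of bilinear multiplications on `ℂⁿ`. The
coordinate with index `(s, i, j, k)` is the coefficient of the `k`-th basis vector in the product of
the `i`-th and the `j`-th one, for the multiplication `[-,-]` if `s = 0` and `{-,-}` if `s = 1`. -/
abbrev PairSpace (n : ℕ) : Type := ZariskiSpace (Fin 2 × Fin n × Fin n × Fin n)

/-- The `s`-th bilinear multiplication on `ℂⁿ` with the structure constants `c`. -/
def mul {n : ℕ} (c : PairSpace n) (s : Fin 2) :
    (Fin n → ℂ) →ₗ[ℂ] (Fin n → ℂ) →ₗ[ℂ] (Fin n → ℂ) :=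
  LinearMap.mk₂ ℂ (fun x y k => ∑ i, ∑ j, x i * y j * c (s, i, j, k))
    (by intros; ext; simp [add_mul, Finset.sum_add_distrib])
    (by intros; ext; simp [mul_assoc, Finset.mul_sum])
    (by intros; ext; simp [add_mul, mul_add, Finset.sum_add_distrib])
    (by intros; ext; simp [mul_assoc, mul_left_comm, Finset.mul_sum])

/-- The variety of `n`-dimensional complex nilpotent compatible Lie algebras. -/
def nilpotentVariety (n : ℕ) : Set (PairSpace n) :=
  {c | IsCompatibleLie (mul c 0) (mul c 1) ∧ IsNilpotentPair (mul c 0) (mul c 1)}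

/-- The `GL_n(ℂ)`-orbit of `c`, for the action `(g * μ)(x, y) = g μ(g⁻¹ x, g⁻¹ y)` on both
multiplications. -/
def orbit {n : ℕ} (c : PairSpace n) : Set (PairSpace n) :=
  {d | ∃ g : (Fin n → ℂ) ≃ₗ[ℂ] (Fin n → ℂ),
    ∀ s x y, mul d s x y = g (mul c s (g.symm x) (g.symm y))}

/-- The Zariski closure of the union of the orbits of the members of a family of algebras. -/
def familyOrbitClosure {n : ℕ} {ι : Type} (T : ι → PairSpace n) : Set (PairSpace n) :=
  closure (⋃ a, orbit (T a))

/-- The family of algebras `T` degenerates to the algebra `A`. -/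
def FamilyDegeneratesTo {n : ℕ} {ι : Type} (T : ι → PairSpace n) (A : PairSpace n) : Prop :=
  A ∈ familyOrbitClosure T

/-! ### The list of four-dimensional algebras

Basis vectors are numbered from `0` here, so that `0, 1, 2, 3` stand for `e₁, e₂, e₃, e₄`. -/

instance (σ : Type) : AddCommGroup (ZariskiSpace σ) := inferInstanceAs (AddCommGroup (σ → ℂ))

/-- The anticommutative pair whose only nonzero products of basis vectors are, for the `s`-th
multiplication, `a` times the `k`-th basis vector for the product of the `i`-th and the `j`-th one,
and the opposite for the product of the `j`-th and the `i`-th one (used for `i ≠ j`). -/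
def term (s : Fin 2) (i j k : Fin 4) (a : ℂ) : PairSpace 4 :=
  fun t => if t = (s, i, j, k) then a else if t = (s, j, i, k) then -a else 0

/-- `sq i j k a` contributes `[e_i, e_j] = a e_k`. -/
abbrev sq (i j k : Fin 4) (a : ℂ) : PairSpace 4 := term 0 i j k a

/-- `cu i j k a` contributes `{e_i, e_j} = a e_k`. -/
abbrev cu (i j k : Fin 4) (a : ℂ) : PairSpace 4 := term 1 i j k a

/-- `{e₁,e₂} = e₃`. -/
def L01 : PairSpace 4 := cu 0 1 2 1

/-- `[e₁,e₂] = e₃`, `{e₁,e₂} = α e₃`. -/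
def L02 (α : ℂ) : PairSpace 4 := sq 0 1 2 1 + cu 0 1 2 α

/-- `[e₂,e₃] = e₄`, `{e₁,e₃} = e₄`. -/
def L03 : PairSpace 4 := sq 1 2 3 1 + cu 0 2 3 1

/-- `[e₁,e₂] = e₃`, `[e₂,e₃] = e₄`, `{e₁,e₂} = e₄`. -/
def L04 : PairSpace 4 := sq 0 1 2 1 + sq 1 2 3 1 + cu 0 1 3 1

/-- `[e₂,e₃] = α e₄`, `{e₁,e₂} = e₃`, `{e₂,e₃} = e₄`. -/
def L05 (α : ℂ) : PairSpace 4 := sq 1 2 3 α + cu 0 1 2 1 + cu 1 2 3 1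

/-- `[e₁,e₃] = e₄`, `{e₁,e₂} = e₃`, `{e₂,e₃} = e₄`. -/
def L06 : PairSpace 4 := sq 0 2 3 1 + cu 0 1 2 1 + cu 1 2 3 1

/-- `[e₁,e₂] = e₄`, `{e₁,e₂} = e₃`, `{e₂,e₃} = e₄`. -/
def L07 : PairSpace 4 := sq 0 1 3 1 + cu 0 1 2 1 + cu 1 2 3 1

/-- `[e₁,e₂] = e₃`, `{e₁,e₂} = α e₃`, `{e₂,e₃} = e₄`. -/
def L08 (α : ℂ) : PairSpace 4 := sq 0 1 2 1 + cu 0 1 2 α + cu 1 2 3 1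

/-- `[e₁,e₂] = e₃`, `[e₂,e₃] = e₄`, `{e₁,e₂} = α e₃`, `{e₂,e₃} = β e₄`. -/
def L09 (α β : ℂ) : PairSpace 4 := sq 0 1 2 1 + sq 1 2 3 1 + cu 0 1 2 α + cu 1 2 3 β

/-- `[e₁,e₂] = e₃`, `[e₂,e₃] = e₄`, `{e₁,e₂} = α e₃`, `{e₁,e₃} = e₄`. -/
def L10 (α : ℂ) : PairSpace 4 := sq 0 1 2 1 + sq 1 2 3 1 + cu 0 1 2 α + cu 0 2 3 1

/-- The algebras of the list other than the members of the family `L10`. -/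
def otherAlgebras : Set (PairSpace 4) :=
  {L01, L03, L04, L06, L07} ∪ Set.range L02 ∪ Set.range L05 ∪ Set.range L08 ∪
    {A | ∃ α β : ℂ, A = L09 α β}

end CompatLie

end

/-!
A four-dimensional nilpotent compatible Lie algebra has a basis adapted to a complete flag in which
each hyperplane contains all products with a factor in the preceding subspace
(`exists_hyperplane`). In such a basis both multiplications have the shape

  `e₁e₂ = a e₃ + b e₄`,  `e₁e₃ = c e₄`,  `e₂e₃ = d e₄`,

and conversely every choice of the eight parameters gives a nilpotent compatible Lie algebra
(`normalPair`), so that `𝒱 = GL₄ · 𝔸⁸`. All four claims follow from this.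

* `𝒱` is closed, being cut out by the identities of a compatible Lie algebra together with
  `x(y(zw)) = 0` and `(xy)(zw) = 0` (`mem_nilpotentVariety_iff_satisfiesIdentities`).
* `𝒱` is the image of the open set `det X ≠ 0` of an affine space under a polynomial map
  (`image_orbitMap`), hence irreducible. Moreover, a nonempty open condition on the source defines a
  dense subset of `𝒱` (`nilpotentVariety_subset_closure`).
* If `a ≠ 0` and the functionals `(c, d)` and `(c', d')` are independent, a change of basis leads to
  `L10` with `α = a' / a` (`normalPair_mem_orbit_L10`). So the orbits of this family are dense in
  `𝒱`. The other algebras of the list are themselves in normal form, so they lie in `𝒱`.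
* What is canonical in the normal form is only the flag of the line `⟨e₄⟩` in the plane `⟨e₃, e₄⟩`;
  such flags have an open chart with five coordinates. This gives a map `flagMap` from the affine
  space of dimension `5 + 8 = 13` with dense image in `𝒱`, and its source coordinates are algebraic
  over its components (`isAlgebraic_X`). Hence the coordinate ring of `𝒱` has transcendence degree
  `13`; the Krull dimension is the same by Noether normalization
  (`ringKrullDim_eq_of_trdeg_eq`), and it is the topological dimension by the Nullstellensatz
  (`topologicalKrullDim_eq_ringKrullDim`).
-/

noncomputable section

namespace CompatLie

open MvPolynomial

/-! ### Krull dimension of finitely generated domains -/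

/-- Incomparability gives one inequality and going up the other. -/
theorem ringKrullDim_eq_of_isIntegral {R S : Type*} [CommRing R] [CommRing S] [IsDomain S]
    [Algebra R S] [Algebra.IsIntegral R S] (hinj : Function.Injective (algebraMap R S)) :
    ringKrullDim S = ringKrullDim R := by
  apply le_antisymm
  · refine Order.krullDim_le_of_strictMono (fun P => PrimeSpectrum.comap (algebraMap R S) P) ?_
    intro P Q h
    exact Ideal.IsIntegral.comap_lt_comap (R := R) (I := P.asIdeal) (J := Q.asIdeal) h
  · refine iSup_le fun l => ?_
    have : (RingHom.ker (algebraMap R S)) ≤ l.head.asIdeal := by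
      rw [(RingHom.injective_iff_ker_eq_bot _).1 hinj]; exact bot_le
    obtain ⟨P, hP, hlo⟩ :=
      Ideal.exists_ideal_over_prime_of_isIntegral_of_isDomain l.head.asIdeal this
    have : P.LiesOver l.head.asIdeal := ⟨hlo.symm⟩
    obtain ⟨L, hL, -⟩ := Ideal.exists_ltSeries_of_hasGoingUp l P
    rw [← hL]
    exact Order.LTSeries.length_le_krullDim L

/-- By Noether normalization, the Krull dimension of a finitely generated domain over a field is its
transcendence degree. -/
theorem ringKrullDim_eq_of_trdeg_eq {k A : Type} [Field k] [CommRing A] [IsDomain A] [Algebra k A]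
    [Algebra.FiniteType k A] {n : ℕ} (h : Algebra.trdeg k A = n) : ringKrullDim A = n := by
  obtain ⟨s, g, hinj, hint⟩ := exists_integral_inj_algHom_of_fg k A
  algebraize [g.toRingHom]
  have : Algebra.IsIntegral (MvPolynomial (Fin s) k) A := ⟨hint⟩
  have : FaithfulSMul (MvPolynomial (Fin s) k) A :=
    (faithfulSMul_iff_algebraMap_injective _ _).2 hinj
  have : IsScalarTower k (MvPolynomial (Fin s) k) A := IsScalarTower.of_algebraMap_eq fun x => by
    exact (g.commutes x).symm
  have h1 := trdeg_add_eq k (MvPolynomial (Fin s) k) (A := A)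
  have h2 : Algebra.trdeg (MvPolynomial (Fin s) k) A = 0 := trdeg_eq_zero
  rw [h2, MvPolynomial.trdeg_of_isDomain, h] at h1
  have hs : s = n := by simpa using h1
  rw [ringKrullDim_eq_of_isIntegral (R := MvPolynomial (Fin s) k) hinj]
  simp [hs]

/-! ### The Zariski topology -/

section Zariski

variable {σ τ : Type}

/-- The zero locus of an ideal, as a subset of affine space with its Zariski topology. -/
def zeros (I : Ideal (MvPolynomial σ ℂ)) : Set (ZariskiSpace σ) := zeroLocus ℂ I

/-- The ideal of the polynomials that vanish on a subset of affine space. -/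
def idealOf (S : Set (ZariskiSpace σ)) : Ideal (MvPolynomial σ ℂ) := vanishingIdeal ℂ S

theorem mem_idealOf {S : Set (ZariskiSpace σ)} {p : MvPolynomial σ ℂ} :
    p ∈ idealOf S ↔ ∀ x ∈ S, aeval (x : σ → ℂ) p = 0 := Iff.rfl

theorem mem_zeros_span {s : Set (MvPolynomial σ ℂ)} {x : ZariskiSpace σ} :
    x ∈ zeros (Ideal.span s) ↔ ∀ p ∈ s, aeval (x : σ → ℂ) p = 0 := by
  rw [zeros, zeroLocus_span]
  rfl

theorem subset_zeros_iff {S : Set (ZariskiSpace σ)} {I : Ideal (MvPolynomial σ ℂ)} :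
    S ⊆ zeros I ↔ I ≤ idealOf S := le_zeroLocus_iff_le_vanishingIdeal

theorem zeros_anti {I J : Ideal (MvPolynomial σ ℂ)} (h : I ≤ J) : zeros J ⊆ zeros I :=
  zeroLocus_anti_mono h

theorem idealOf_anti {S T : Set (ZariskiSpace σ)} (h : S ⊆ T) : idealOf T ≤ idealOf S :=
  vanishingIdeal_anti_mono h

theorem idealOf_zeros [Finite σ] (P : Ideal (MvPolynomial σ ℂ)) [P.IsPrime] :
    idealOf (zeros P) = P :=
  IsPrime.vanishingIdeal_zeroLocus P

theorem isClosed_iff {Z : Set (ZariskiSpace σ)} :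
    IsClosed Z ↔ ∃ I : Ideal (MvPolynomial σ ℂ), zeros I = Z := by
  rw [← isOpen_compl_iff]
  change Zᶜᶜ ∈ _ ↔ _
  rw [compl_compl]
  rfl

theorem isClosed_zeros (I : Ideal (MvPolynomial σ ℂ)) : IsClosed (zeros I) :=
  isClosed_iff.2 ⟨I, rfl⟩

theorem zeros_idealOf {Z : Set (ZariskiSpace σ)} (hZ : IsClosed Z) : zeros (idealOf Z) = Z := by
  obtain ⟨I, rfl⟩ := isClosed_iff.1 hZ
  exact (zeros_anti (subset_zeros_iff.1 subset_rfl)).antisymm (subset_zeros_iff.2 le_rfl)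

theorem idealOf_closure (S : Set (ZariskiSpace σ)) : idealOf (closure S) = idealOf S :=
  (idealOf_anti subset_closure).antisymm
    (subset_zeros_iff.1 (closure_minimal (subset_zeros_iff.2 le_rfl) (isClosed_zeros _)))

theorem isPrime_idealOf {S : Set (ZariskiSpace σ)} (hS : IsIrreducible S) :
    (idealOf S).IsPrime := by
  constructor
  · obtain ⟨x, hx⟩ := hS.nonempty
    rw [Ne, Ideal.eq_top_iff_one]
    intro h
    simpa using mem_idealOf.1 h x hx
  · intro p q hpq
    have key : ∀ r : MvPolynomial σ ℂ, S ⊆ zeros (Ideal.span {r}) ↔ r ∈ idealOf S := fun r => by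
      rw [subset_zeros_iff, Ideal.span_singleton_le_iff_mem]
    rw [← key, ← key]
    refine isPreirreducible_iff_isClosed_union_isClosed.1 hS.isPreirreducible _ _
      (isClosed_zeros _) (isClosed_zeros _) fun x hx => ?_
    have := mem_idealOf.1 hpq x hx
    rw [map_mul, mul_eq_zero] at this
    simpa [mem_zeros_span] using this

theorem isIrreducible_zeros [Finite σ] (P : Ideal (MvPolynomial σ ℂ)) [hP : P.IsPrime] :
    IsIrreducible (zeros P) := by
  constructor
  · rw [Set.nonempty_iff_ne_empty]
    intro h
    refine hP.ne_top ?_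
    rw [← idealOf_zeros P, h]
    exact vanishingIdeal_empty
  · rw [isPreirreducible_iff_isClosed_union_isClosed]
    intro A B hA hB hAB
    obtain ⟨I, rfl⟩ := isClosed_iff.1 hA
    obtain ⟨J, rfl⟩ := isClosed_iff.1 hB
    have hIJ : I * J ≤ P := by
      rw [← idealOf_zeros P, ← subset_zeros_iff]
      exact hAB.trans (Set.union_subset (zeros_anti Ideal.mul_le_left)
        (zeros_anti Ideal.mul_le_right))
    exact (hP.mul_le.1 hIJ).imp zeros_anti zeros_anti

instance [Finite σ] : IrreducibleSpace (ZariskiSpace σ) := by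
  have h := isIrreducible_zeros (⊥ : Ideal (MvPolynomial σ ℂ))
  rw [show zeros (⊥ : Ideal (MvPolynomial σ ℂ)) = Set.univ from zeroLocus_bot] at h
  exact (irreducibleSpace_def _).2 h

/-- The Nullstellensatz identifies the irreducible closed subsets of a Zariski closed set with the
primes of its coordinate ring. -/
theorem topologicalKrullDim_eq_ringKrullDim [Finite σ] {Z : Set (ZariskiSpace σ)}
    (hZ : IsClosed Z) :
    topologicalKrullDim Z = ringKrullDim (MvPolynomial σ ℂ ⧸ idealOf Z) := by
  rw [ringKrullDim_quotient, ← Order.krullDim_orderDual (α := PrimeSpectrum.zeroLocus _)]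
  have hcl : ∀ S : TopologicalSpace.IrreducibleCloseds Z,
      IsClosed (Subtype.val '' (S : Set Z) : Set (ZariskiSpace σ)) := fun S =>
    hZ.isClosedMap_subtype_val _ S.isClosed
  have hirr : ∀ S : TopologicalSpace.IrreducibleCloseds Z,
      IsIrreducible (Subtype.val '' (S : Set Z) : Set (ZariskiSpace σ)) := fun S =>
    S.isIrreducible.image _ continuous_subtype_val.continuousOn
  apply le_antisymm
  · refine Order.krullDim_le_of_strictMono (fun S => OrderDual.toDual
      ⟨⟨idealOf (Subtype.val '' (S : Set Z)), isPrime_idealOf (hirr S)⟩,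
        idealOf_anti (Subtype.coe_image_subset Z S)⟩) ?_
    refine Monotone.strictMono_of_injective ?_ ?_
    · intro S T h
      exact idealOf_anti (Set.image_mono h)
    · intro S T h
      have h' : idealOf (Subtype.val '' (S : Set Z)) =
          idealOf (Subtype.val '' (T : Set Z)) :=
        congrArg (fun P => (OrderDual.ofDual P).1.asIdeal) h
      have h'' := congrArg zeros h'
      rw [zeros_idealOf (hcl S),
        zeros_idealOf (hcl T)] at h''
      exact TopologicalSpace.IrreducibleCloseds.ext (Subtype.val_injective.image_injective h'')
  · have hsub : ∀ P : PrimeSpectrum.zeroLocus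
        (idealOf Z : Set (MvPolynomial σ ℂ)), zeros P.1.asIdeal ⊆ Z := fun P => by
      conv_rhs => rw [← zeros_idealOf hZ]
      exact zeros_anti P.2
    refine Order.krullDim_le_of_strictMono (fun P =>
      ⟨Subtype.val ⁻¹' (zeros (OrderDual.ofDual P).1.asIdeal), ?_, ?_⟩) ?_
    · have hi := isIrreducible_zeros (OrderDual.ofDual P).1.asIdeal
      refine ⟨?_, ?_⟩
      · obtain ⟨x, hx⟩ := hi.nonempty
        exact ⟨⟨x, hsub _ hx⟩, hx⟩
      · rw [isPreirreducible_iff_isClosed_union_isClosed]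
        intro A B hA hB hAB
        have hAB' := Set.image_mono (f := Subtype.val) hAB
        rw [Subtype.image_preimage_coe, Set.inter_eq_right.2 (hsub _), Set.image_union] at hAB'
        refine (isPreirreducible_iff_isClosed_union_isClosed.1 hi.isPreirreducible _ _
          (hZ.isClosedMap_subtype_val _ hA) (hZ.isClosedMap_subtype_val _ hB) hAB').imp ?_ ?_ <;>
        · intro h x hx
          obtain ⟨y, hy, hyx⟩ := h hx
          exact Subtype.val_injective hyx ▸ hy
    · exact (isClosed_zeros _).preimage continuous_subtype_val
    · refine Monotone.strictMono_of_injective ?_ ?_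
      · intro P Q h
        have h' : (OrderDual.ofDual Q).1.asIdeal ≤ (OrderDual.ofDual P).1.asIdeal := h
        exact fun x hx => zeros_anti h' hx
      · intro P Q h
        have h' : (Subtype.val ⁻¹' zeros (OrderDual.ofDual P).1.asIdeal : Set Z) =
            Subtype.val ⁻¹' zeros (OrderDual.ofDual Q).1.asIdeal :=
          congrArg TopologicalSpace.IrreducibleCloseds.carrier h
        have h'' := congrArg (Set.image Subtype.val) h'
        rw [Subtype.image_preimage_coe, Set.inter_eq_right.2 (hsub _), Subtype.image_preimage_coe,
          Set.inter_eq_right.2 (hsub _)] at h''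
        have h3 := congrArg idealOf h''
        rw [idealOf_zeros, idealOf_zeros] at h3
        exact congrArg OrderDual.toDual (Subtype.ext (PrimeSpectrum.ext h3))

/-- A function on affine space is polynomial: it is the evaluation of some polynomial. -/
def IsPoly (f : ZariskiSpace τ → ℂ) : Prop :=
  ∃ p : MvPolynomial τ ℂ, ∀ x : τ → ℂ, aeval x p = f x

namespace IsPoly

variable {f g : ZariskiSpace τ → ℂ}

theorem coord (i : τ) : IsPoly (fun x : ZariskiSpace τ => x i) := ⟨X i, fun x => aeval_X x i⟩

theorem const (a : ℂ) : IsPoly (fun _ : ZariskiSpace τ => a) := ⟨C a, fun x => by simp⟩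

theorem add (hf : IsPoly f) (hg : IsPoly g) : IsPoly (fun x => f x + g x) := by
  obtain ⟨p, hp⟩ := hf
  obtain ⟨q, hq⟩ := hg
  exact ⟨p + q, fun x => by rw [map_add, hp, hq]⟩

theorem mul (hf : IsPoly f) (hg : IsPoly g) : IsPoly (fun x => f x * g x) := by
  obtain ⟨p, hp⟩ := hf
  obtain ⟨q, hq⟩ := hg
  exact ⟨p * q, fun x => by rw [map_mul, hp, hq]⟩

theorem neg (hf : IsPoly f) : IsPoly (fun x => -f x) := by
  obtain ⟨p, hp⟩ := hf
  exact ⟨-p, fun x => by rw [map_neg, hp]⟩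

theorem sub (hf : IsPoly f) (hg : IsPoly g) : IsPoly (fun x => f x - g x) := by
  simpa only [sub_eq_add_neg] using hf.add hg.neg

theorem sum {ι : Type*} (s : Finset ι) {F : ι → ZariskiSpace τ → ℂ} (h : ∀ i ∈ s, IsPoly (F i)) :
    IsPoly (fun x => ∑ i ∈ s, F i x) := by
  classical
  induction s using Finset.induction_on with
  | empty => simpa using const 0
  | insert a s ha ih =>
    simp only [Finset.sum_insert ha]
    exact (h a (Finset.mem_insert_self a s)).add
      (ih fun i hi => h i (Finset.mem_insert_of_mem hi))

theorem prod {ι : Type*} (s : Finset ι) {F : ι → ZariskiSpace τ → ℂ} (h : ∀ i ∈ s, IsPoly (F i)) :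
    IsPoly (fun x => ∏ i ∈ s, F i x) := by
  classical
  induction s using Finset.induction_on with
  | empty => simpa using const 1
  | insert a s ha ih =>
    simp only [Finset.prod_insert ha]
    exact (h a (Finset.mem_insert_self a s)).mul
      (ih fun i hi => h i (Finset.mem_insert_of_mem hi))

theorem isClosed (hf : IsPoly f) : IsClosed {x | f x = 0} := by
  obtain ⟨p, hp⟩ := hf
  refine isClosed_iff.2 ⟨Ideal.span {p}, ?_⟩
  ext x
  simp only [mem_zeros_span, Set.mem_singleton_iff, forall_eq]
  exact Eq.congr_left (hp x)

theorem isOpen (hf : IsPoly f) : IsOpen {x | f x ≠ 0} := hf.isClosed.isOpen_compl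

end IsPoly

theorem continuous_of_isPoly {F : ZariskiSpace τ → ZariskiSpace σ}
    (hF : ∀ i, IsPoly (fun x => F x i)) : Continuous F := by
  choose p hp using hF
  refine continuous_iff_isClosed.2 fun Z hZ => ?_
  obtain ⟨I, rfl⟩ := isClosed_iff.1 hZ
  refine isClosed_iff.2 ⟨I.map (aeval p : MvPolynomial σ ℂ →ₐ[ℂ] MvPolynomial τ ℂ), ?_⟩
  have key : ∀ (x : τ → ℂ) (q : MvPolynomial σ ℂ), aeval x (aeval p q) = aeval (F x) q :=
    fun x q => by
    have hFx : F x = fun i => aeval x (p i) := funext fun i => (hp i x).symm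
    rw [hFx, ← AlgHom.comp_apply, comp_aeval]
  ext x
  rw [Ideal.map, mem_zeros_span]
  simp only [Set.mem_image, forall_exists_index, and_imp, forall_apply_eq_imp_iff₂]
  exact forall₂_congr fun q _ => Eq.congr_left (key x q)

/-- The closure of the image of a polynomial map `F` from affine `n`-space has dimension `n` as soon
as the coordinates of the source are algebraic over the algebra generated by the components of
`F`. -/
theorem topologicalKrullDim_closure_range [Finite σ] [Finite τ]
    {F : ZariskiSpace τ → ZariskiSpace σ}
    (p : σ → MvPolynomial τ ℂ) (hp : ∀ (x : τ → ℂ) i, aeval x (p i) = F x i)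
    (halg : ∀ j, IsAlgebraic (aeval p : MvPolynomial σ ℂ →ₐ[ℂ] MvPolynomial τ ℂ).range
      (X j : MvPolynomial τ ℂ)) :
    topologicalKrullDim (closure (Set.range F)) = Nat.card τ := by
  rw [topologicalKrullDim_eq_ringKrullDim isClosed_closure, idealOf_closure]
  set φ : MvPolynomial σ ℂ →ₐ[ℂ] MvPolynomial τ ℂ := aeval p with hφ
  have hker : idealOf (Set.range F) = RingHom.ker φ := by
    ext q
    rw [RingHom.mem_ker]
    have key : ∀ x : τ → ℂ, aeval x (φ q) = aeval (F x) q := fun x => by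
      have hFx : F x = fun i => aeval x (p i) := funext fun i => (hp x i).symm
      rw [hFx, hφ, ← AlgHom.comp_apply, comp_aeval]
    constructor
    · intro h
      refine MvPolynomial.funext fun x => ?_
      rw [map_zero, ← coe_aeval_eq_eval]
      exact (key x).trans (h _ ⟨x, rfl⟩)
    · rintro h _ ⟨x, rfl⟩
      refine (key x).symm.trans ?_
      rw [h, map_zero]
  rw [hker, ringKrullDim_eq_of_ringEquiv (Ideal.quotientKerEquivRange φ).toRingEquiv]
  have : Algebra.FiniteType ℂ φ.range :=
    Algebra.FiniteType.of_surjective φ.rangeRestrict φ.rangeRestrict_surjective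
  apply ringKrullDim_eq_of_trdeg_eq (k := ℂ)
  have htop : Subalgebra.algebraicClosure φ.range (MvPolynomial τ ℂ) = ⊤ := by
    have h1 : (Subalgebra.algebraicClosure φ.range (MvPolynomial τ ℂ)).restrictScalars ℂ = ⊤ := by
      rw [eq_top_iff, ← MvPolynomial.adjoin_range_X, Algebra.adjoin_le_iff]
      rintro _ ⟨j, rfl⟩
      exact halg j
    exact eq_top_iff.2 fun x _ => (h1 ▸ Algebra.mem_top : x ∈ (Subalgebra.algebraicClosure φ.range
      (MvPolynomial τ ℂ)).restrictScalars ℂ)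
  have : Algebra.IsAlgebraic φ.range (MvPolynomial τ ℂ) :=
    ⟨fun x => (htop ▸ Algebra.mem_top : x ∈ Subalgebra.algebraicClosure φ.range _)⟩
  have h1 := trdeg_add_eq ℂ φ.range (A := MvPolynomial τ ℂ)
  rw [show Algebra.trdeg φ.range (MvPolynomial τ ℂ) = 0 from trdeg_eq_zero, add_zero,
    MvPolynomial.trdeg_of_isDomain] at h1
  rw [h1]
  simp [Nat.cast_card]

end Zariski

end CompatLie

namespace CompatLie

open Matrix

/-! ### Nilpotency of class at most three -/

section Powers

variable {V : Type} [AddCommGroup V] [Module ℂ V]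

theorem power_one (f g : V →ₗ[ℂ] V →ₗ[ℂ] V) : power f g 1 = ⊤ := by rw [power]

theorem power_add_two (f g : V →ₗ[ℂ] V →ₗ[ℂ] V) (n : ℕ) :
    power f g (n + 2) = ⨆ i : Fin (n + 1),
      Submodule.map₂ f (power f g (i + 1)) (power f g (n + 1 - i)) ⊔
        Submodule.map₂ g (power f g (i + 1)) (power f g (n + 1 - i)) := by rw [power]

/-- If two multiplications are anticommutative, the vanishing of the products
`x(y(zw))` and `(xy)(zw)` kills the fourth power. -/
theorem power_four_eq_bot {μ : Fin 2 → V →ₗ[ℂ] V →ₗ[ℂ] V} (halt : ∀ s x, μ s x x = 0)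
    (h₁ : ∀ s t u x y z w, μ s x (μ t y (μ u z w)) = 0)
    (h₂ : ∀ s t u x y z w, μ s (μ t x y) (μ u z w) = 0) : power (μ 0) (μ 1) 4 = ⊥ := by
  have hskew : ∀ s x y, μ s x y = -μ s y x := fun s x y => by
    have := halt s (x + y)
    simp only [map_add, LinearMap.add_apply, halt, zero_add, add_zero] at this
    exact eq_neg_of_add_eq_zero_right this
  have h2 : ∀ N : Submodule ℂ V, (∀ s x y, μ s x y ∈ N) → power (μ 0) (μ 1) 2 ≤ N := by
    intro N hN
    rw [power_add_two]
    exact iSup_le fun i => sup_le (Submodule.map₂_le.2 fun x _ y _ => hN 0 x y)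
      (Submodule.map₂_le.2 fun x _ y _ => hN 1 x y)
  have h3 : ∀ N : Submodule ℂ V, (∀ s t x y z, μ s x (μ t y z) ∈ N) → power (μ 0) (μ 1) 3 ≤ N := by
    intro N hN
    have hr : ∀ s x, ∀ y ∈ power (μ 0) (μ 1) 2, μ s x y ∈ N := fun s x y hy =>
      h2 (N.comap (μ s x)) (fun t y z => hN s t x y z) hy
    have hl : ∀ s x, ∀ y ∈ power (μ 0) (μ 1) 2, μ s y x ∈ N := fun s x y hy => by
      rw [hskew]
      exact N.neg_mem (hr s x y hy)
    rw [power_add_two]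
    refine iSup_le fun i => ?_
    fin_cases i
    · exact sup_le (Submodule.map₂_le.2 fun x _ y hy => hr 0 x y hy)
        (Submodule.map₂_le.2 fun x _ y hy => hr 1 x y hy)
    · exact sup_le (Submodule.map₂_le.2 fun x hx y _ => hl 0 y x hx)
        (Submodule.map₂_le.2 fun x hx y _ => hl 1 y x hx)
  have hr : ∀ s x, ∀ y ∈ power (μ 0) (μ 1) 3, μ s x y = 0 := fun s x y hy =>
    h3 (LinearMap.ker (μ s x)) (fun t u y z w => h₁ s t u x y z w) hy
  have hl : ∀ s x, ∀ y ∈ power (μ 0) (μ 1) 3, μ s y x = 0 := fun s x y hy => by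
    rw [hskew, hr s x y hy, neg_zero]
  have hm : ∀ s, ∀ x ∈ power (μ 0) (μ 1) 2, ∀ y ∈ power (μ 0) (μ 1) 2, μ s x y = 0 := by
    intro s x hx y hy
    refine h2 (LinearMap.ker (μ s x)) (fun u z w => ?_) hy
    exact h2 (LinearMap.ker ((μ s).flip (μ u z w))) (fun t x y => h₂ s t u x y z w) hx
  rw [eq_bot_iff, power_add_two]
  refine iSup_le fun i => ?_
  fin_cases i
  · exact sup_le (Submodule.map₂_le.2 fun x _ y hy => hr 0 x y hy)
      (Submodule.map₂_le.2 fun x _ y hy => hr 1 x y hy)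
  · exact sup_le (Submodule.map₂_le.2 fun x hx y hy => hm 0 x hx y hy)
      (Submodule.map₂_le.2 fun x hx y hy => hm 1 x hx y hy)
  · exact sup_le (Submodule.map₂_le.2 fun x hx y _ => hl 0 y x hx)
      (Submodule.map₂_le.2 fun x hx y _ => hl 1 y x hx)

/-- In a nilpotent algebra, a nonzero subspace `S` has a hyperplane that contains all products with
a factor in `S`: otherwise `S` would be contained in all the powers. -/
theorem exists_hyperplane [FiniteDimensional ℂ V] {μ : Fin 2 → V →ₗ[ℂ] V →ₗ[ℂ] V}
    (hnil : IsNilpotentPair (μ 0) (μ 1)) {S : Submodule ℂ V} (hS : S ≠ ⊥)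
    (hmul : ∀ s x, ∀ y ∈ S, μ s x y ∈ S) :
    ∃ (v : V) (T : Submodule ℂ V), S = Submodule.span ℂ {v} ⊔ T ∧
      Module.finrank ℂ S = Module.finrank ℂ T + 1 ∧ ∀ s x, ∀ y ∈ S, μ s x y ∈ T := by
  set P : Submodule ℂ V := Submodule.map₂ (μ 0) ⊤ S ⊔ Submodule.map₂ (μ 1) ⊤ S with hP
  have hPmem : ∀ s x, ∀ y ∈ S, μ s x y ∈ P := by
    intro s x y hy
    fin_cases s
    · exact Submodule.mem_sup_left (Submodule.apply_mem_map₂ _ trivial hy)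
    · exact Submodule.mem_sup_right (Submodule.apply_mem_map₂ _ trivial hy)
  have hPS : P ≤ S := sup_le (Submodule.map₂_le.2 fun x _ y hy => hmul 0 x y hy)
    (Submodule.map₂_le.2 fun x _ y hy => hmul 1 x y hy)
  have hlt : P < S := by
    refine lt_of_le_of_ne hPS fun hPS' => hS ?_
    obtain ⟨m, hm, hbot⟩ := hnil
    have hpow : ∀ n, S ≤ power (μ 0) (μ 1) (n + 1) := by
      intro n
      induction n with
      | zero => rw [power_one]; exact le_top
      | succ n ih =>
        rw [power_add_two]
        refine le_trans ?_ (le_iSup _ 0)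
        calc S = P := hPS'.symm
          _ ≤ _ := by
            simp only [Fin.val_zero, zero_add, power_one, Nat.sub_zero]
            exact sup_le_sup (Submodule.map₂_le_map₂_right ih) (Submodule.map₂_le_map₂_right ih)
    obtain ⟨n, rfl⟩ : ∃ n, m = n + 1 := ⟨m - 1, by omega⟩
    exact eq_bot_iff.2 (hbot ▸ hpow n)
  obtain ⟨T, hPT, hT⟩ := exists_le_covBy_of_lt hlt
  obtain ⟨v, hvS, hvT⟩ := SetLike.exists_of_lt hT.lt
  have hST : S = Submodule.span ℂ {v} ⊔ T := by
    refine ((hT.eq_or_eq le_sup_right (sup_le ?_ hT.le)).resolve_left fun h => hvT ?_).symm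
    · exact (Submodule.span_singleton_le_iff_mem v S).2 hvS
    · rw [← h]
      exact Submodule.mem_sup_left (Submodule.mem_span_singleton_self v)
  refine ⟨v, T, hST, ?_, fun s x y hy => hPT (hPmem s x y hy)⟩
  have h₁ := Submodule.finrank_lt_finrank_of_lt hT.lt
  have h₂ := Submodule.finrank_add_le_finrank_add_finrank (Submodule.span ℂ {v}) T
  rw [← hST] at h₂
  have hv : v ≠ 0 := fun h => hvT (h ▸ T.zero_mem)
  rw [finrank_span_singleton hv] at h₂
  omega

end Powers

/-! ### Multiplications, orbits and the normal form -/

section General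

variable {n : ℕ}

theorem mul_apply (c : PairSpace n) (s : Fin 2) (x y : Fin n → ℂ) (k : Fin n) :
    mul c s x y k = ∑ i, ∑ j, x i * y j * c (s, i, j, k) := rfl

theorem mul_single_single (c : PairSpace n) (s : Fin 2) (i j k : Fin n) :
    mul c s (Pi.single i 1) (Pi.single j 1) k = c (s, i, j, k) := by
  simp [mul_apply, Pi.single_apply]

theorem eq_of_mul_eq {c d : PairSpace n} (h : ∀ s x y, mul c s x y = mul d s x y) : c = d := by
  funext ⟨s, i, j, k⟩
  exact (mul_single_single c s i j k).symm.trans ((congrFun (h s _ _) k).trans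
    (mul_single_single d s i j k))

theorem add_mul_apply (c d : PairSpace n) (s : Fin 2) (x y : Fin n → ℂ) :
    mul (c + d) s x y = mul c s x y + mul d s x y := by
  funext k
  simp only [mul_apply, Pi.add_apply, ← Finset.sum_add_distrib]
  exact Finset.sum_congr rfl fun i _ => Finset.sum_congr rfl fun j _ => mul_add _ _ _

theorem mul_skew {c : PairSpace n} (halt : ∀ s x, mul c s x x = 0) (s : Fin 2)
    (x y : Fin n → ℂ) : mul c s x y = -mul c s y x := by
  have := halt s (x + y)
  simp only [map_add, LinearMap.add_apply, halt, zero_add, add_zero] at this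
  exact eq_neg_of_add_eq_zero_right this

theorem mul_self_eq_zero_of_isCompatibleLie {c : PairSpace n}
    (h : IsCompatibleLie (mul c 0) (mul c 1)) (s : Fin 2) (x : Fin n → ℂ) : mul c s x x = 0 := by
  fin_cases s
  exacts [h.alt_left x, h.alt_right x]

theorem mem_orbit_iff {c d : PairSpace n} : d ∈ orbit c ↔
    ∃ g : (Fin n → ℂ) ≃ₗ[ℂ] (Fin n → ℂ), ∀ s x y, mul d s (g x) (g y) = g (mul c s x y) := by
  refine exists_congr fun g => ⟨fun h s x y => ?_, fun h s x y => ?_⟩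
  · simp [h]
  · simp [← h]

theorem orbit_trans {a b c : PairSpace n} (hab : b ∈ orbit a) (hbc : c ∈ orbit b) :
    c ∈ orbit a := by
  obtain ⟨g, hg⟩ := mem_orbit_iff.1 hab
  obtain ⟨h, hh⟩ := mem_orbit_iff.1 hbc
  exact mem_orbit_iff.2 ⟨g.trans h, fun s x y => by simp [hg, hh]⟩

/-- The pair with the multiplications `X μ(Y x, Y y)`, which is `X * μ` if `Y = X⁻¹`. Keeping `X`
and `Y` apart makes this polynomial in all its arguments. -/
def conj (X Y : Matrix (Fin n) (Fin n) ℂ) (c : PairSpace n) : PairSpace n :=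
  fun t => (X *ᵥ mul c t.1 (fun l => Y l t.2.1) (fun l => Y l t.2.2.1)) t.2.2.2

theorem mul_conj (X Y : Matrix (Fin n) (Fin n) ℂ) (c : PairSpace n) (s : Fin 2)
    (x y : Fin n → ℂ) : mul (conj X Y c) s x y = X *ᵥ mul c s (Y *ᵥ x) (Y *ᵥ y) := by
  have key : mul (conj X Y c) s =
      ((mul c s).compl₁₂ (toLin' Y) (toLin' Y)).compr₂ (toLin' X) := by
    refine LinearMap.pi_ext' fun i => LinearMap.ext_ring (LinearMap.pi_ext' fun j =>
      LinearMap.ext_ring ?_)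
    funext k
    simp only [LinearMap.comp_apply, LinearMap.coe_single, LinearMap.compr₂_apply,
      LinearMap.compl₁₂_apply, toLin'_apply, mulVec_single_one, mul_single_single]
    rfl
  rw [key]
  rfl

theorem conj_mem_orbit {X Y : Matrix (Fin n) (Fin n) ℂ} (h : X * Y = 1) (c : PairSpace n) :
    conj X Y c ∈ orbit c := by
  have h' : Y * X = 1 := mul_eq_one_comm.1 h
  exact ⟨toLin'OfInv h' h, fun s x y => by rw [mul_conj]; rfl⟩

end General

theorem mul_term {i j : Fin 4} (hij : i ≠ j) (s s' : Fin 2) (k : Fin 4) (a : ℂ) (x y : Fin 4 → ℂ) :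
    mul (term s i j k a) s' x y =
      if s' = s then Pi.single k (a * (x i * y j - x j * y i)) else 0 := by
  funext l
  have hsum : ∀ (p q : Fin 4) (b : ℂ), ∑ i', ∑ j', x i' * y j' *
      (if (s', i', j', l) = (s, p, q, k) then b else 0) =
        if s' = s ∧ l = k then x p * y q * b else 0 := by
    intro p q b
    rw [Finset.sum_eq_single p, Finset.sum_eq_single q]
    · simp [Prod.ext_iff]
    · intro j' _ hj'; simp [hj']
    · simp
    · intro i' _ hi'; simp [hi']
    · simp
  have hterm : ∀ t, term s i j k a t =
      (if t = (s, i, j, k) then a else 0) + (if t = (s, j, i, k) then -a else 0) := by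
    intro t
    unfold term
    by_cases h : t = (s, i, j, k)
    · simp [h, hij]
    · simp [h]
  simp only [mul_apply, hterm, mul_add, Finset.sum_add_distrib, hsum]
  by_cases hs : s' = s <;> by_cases hl : l = k <;> simp [hs, hl]
  ring

theorem term_zero (s : Fin 2) (i j k : Fin 4) : term s i j k 0 = 0 := by
  funext t
  simp [term]
  rfl

/-- The parameters of a pair in normal form: for each of the two multiplications, the coefficients
of `e₃` and `e₄` in `e₁e₂` (indices `0` and `1`) and those of `e₄` in `e₁e₃` and `e₂e₃` (indices
`2` and `3`). -/
abbrev Params : Type := ZariskiSpace (Fin 2 × Fin 4)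

/-- The pair in normal form with parameters `m`. -/
def normalPair (m : Params) : PairSpace 4 :=
  sq 0 1 2 (m (0, 0)) + sq 0 1 3 (m (0, 1)) + sq 0 2 3 (m (0, 2)) + sq 1 2 3 (m (0, 3)) +
    (cu 0 1 2 (m (1, 0)) + cu 0 1 3 (m (1, 1)) + cu 0 2 3 (m (1, 2)) + cu 1 2 3 (m (1, 3)))

theorem mul_normalPair (m : Params) (s : Fin 2) (x y : Fin 4 → ℂ) :
    mul (normalPair m) s x y = ![0, 0, m (s, 0) * (x 0 * y 1 - x 1 * y 0),
      m (s, 1) * (x 0 * y 1 - x 1 * y 0) + m (s, 2) * (x 0 * y 2 - x 2 * y 0) +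
        m (s, 3) * (x 1 * y 2 - x 2 * y 1)] := by
  unfold normalPair sq cu
  simp only [add_mul_apply]
  rw [mul_term, mul_term, mul_term, mul_term, mul_term, mul_term, mul_term, mul_term] <;>
    try decide
  funext k
  fin_cases s <;> fin_cases k <;> simp

theorem mul_normalPair_eq_smul (m : Params) (s : Fin 2) (x y : Fin 4 → ℂ) :
    mul (normalPair m) s x y = (m (s, 0) * (x 0 * y 1 - x 1 * y 0)) • Pi.single 2 1 +
      (m (s, 1) * (x 0 * y 1 - x 1 * y 0) + m (s, 2) * (x 0 * y 2 - x 2 * y 0) +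
        m (s, 3) * (x 1 * y 2 - x 2 * y 1)) • Pi.single 3 1 := by
  rw [mul_normalPair]
  funext k
  fin_cases k <;> simp

/-- A nilpotent compatible Lie algebra of dimension four is given by polynomial identities: besides
those of a compatible Lie algebra, the products `x(y(zw))` and `(xy)(zw)` vanish. -/
structure SatisfiesIdentities (c : PairSpace 4) : Prop where
  compatible : IsCompatibleLie (mul c 0) (mul c 1)
  right_normed : ∀ s t u x y z w, mul c s x (mul c t y (mul c u z w)) = 0
  product_of_products : ∀ s t u x y z w, mul c s (mul c t x y) (mul c u z w) = 0

theorem SatisfiesIdentities.mem_nilpotentVariety {c : PairSpace 4} (h : SatisfiesIdentities c) :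
    c ∈ nilpotentVariety 4 := by
  exact ⟨h.compatible, 4, by norm_num, power_four_eq_bot (μ := mul c)
    (mul_self_eq_zero_of_isCompatibleLie h.compatible) h.right_normed h.product_of_products⟩

theorem satisfiesIdentities_normalPair (m : Params) : SatisfiesIdentities (normalPair m) where
  compatible := by
    constructor <;> intros <;> simp only [mul_normalPair] <;> funext k <;> fin_cases k <;>
      simp [-mul_eq_zero] <;> ring
  right_normed := by intros; simp [mul_normalPair]
  product_of_products := by intros; simp [mul_normalPair]

theorem SatisfiesIdentities.of_mem_orbit {c d : PairSpace 4} (h : SatisfiesIdentities c)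
    (hd : d ∈ orbit c) : SatisfiesIdentities d := by
  obtain ⟨g, hg⟩ := mem_orbit_iff.1 hd
  have hs := g.surjective
  refine ⟨⟨hs.forall.2 fun x => ?_, hs.forall.2 fun x => ?_, hs.forall₃.2 fun x y z => ?_,
    hs.forall₃.2 fun x y z => ?_, hs.forall₃.2 fun x y z => ?_⟩,
    fun s t u => hs.forall₂.2 fun x y => hs.forall₂.2 fun z w => ?_,
    fun s t u => hs.forall₂.2 fun x y => hs.forall₂.2 fun z w => ?_⟩
  · rw [hg, h.compatible.alt_left, map_zero]
  · rw [hg, h.compatible.alt_right, map_zero]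
  · simp only [hg, ← map_add, h.compatible.jacobi_left, map_zero]
  · simp only [hg, ← map_add, h.compatible.jacobi_right, map_zero]
  · simp only [hg, ← map_add, h.compatible.compat, map_zero]
  · simp only [hg, h.right_normed, map_zero]
  · simp only [hg, h.product_of_products, map_zero]

theorem isPoly_mul {τ : Type} {n : ℕ} {c : ZariskiSpace τ → PairSpace n}
    {x y : ZariskiSpace τ → Fin n → ℂ} (hc : ∀ t, IsPoly fun p => c p t)
    (hx : ∀ i, IsPoly fun p => x p i) (hy : ∀ i, IsPoly fun p => y p i) (s : Fin 2) (k : Fin n) :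
    IsPoly fun p => mul (c p) s (x p) (y p) k :=
  IsPoly.sum Finset.univ fun i _ => IsPoly.sum Finset.univ fun j _ =>
    ((hx i).mul (hy j)).mul (hc (s, i, j, k))

theorem isClosed_setOf_satisfiesIdentities : IsClosed {c | SatisfiesIdentities c} := by
  have hc : ∀ t, IsPoly fun c : PairSpace 4 => c t := fun t => .coord t
  have hv : ∀ (x : Fin 4 → ℂ) i, IsPoly fun _ : PairSpace 4 => x i := fun x i => .const (x i)
  -- A product of vectors that depend polynomially on `c`.
  have hm : ∀ s {x y : PairSpace 4 → Fin 4 → ℂ}, (∀ i, IsPoly fun c => x c i) →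
      (∀ i, IsPoly fun c => y c i) → ∀ k, IsPoly fun c => mul c s (x c) (y c) k :=
    fun s _ _ hx hy k => isPoly_mul hc hx hy s k
  have h0 : ∀ {x : PairSpace 4 → Fin 4 → ℂ}, (∀ k, IsPoly fun c => x c k) →
      IsClosed {c | x c = 0} := fun hx => by
    simp only [funext_iff, Set.ofPred_forall]
    exact isClosed_iInter fun k => (hx k).isClosed
  have h1 : ∀ s, IsClosed {c : PairSpace 4 | ∀ x, mul c s x x = 0} := fun s => by
    simp only [Set.ofPred_forall]
    exact isClosed_iInter fun x => h0 (hm s (hv x) (hv x))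
  have h2 : ∀ s, IsClosed {c : PairSpace 4 | ∀ x y z, mul c s (mul c s x y) z +
      mul c s (mul c s y z) x + mul c s (mul c s z x) y = 0} := fun s => by
    simp only [Set.ofPred_forall]
    exact isClosed_iInter fun x => isClosed_iInter fun y => isClosed_iInter fun z => h0 fun k =>
      ((hm s (hm s (hv x) (hv y)) (hv z) k).add (hm s (hm s (hv y) (hv z)) (hv x) k)).add
        (hm s (hm s (hv z) (hv x)) (hv y) k)
  have h3 : IsClosed {c : PairSpace 4 | ∀ x y z, mul c 1 (mul c 0 x y) z +
      mul c 1 (mul c 0 y z) x + mul c 1 (mul c 0 z x) y + mul c 0 (mul c 1 x y) z +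
      mul c 0 (mul c 1 y z) x + mul c 0 (mul c 1 z x) y = 0} := by
    simp only [Set.ofPred_forall]
    exact isClosed_iInter fun x => isClosed_iInter fun y => isClosed_iInter fun z => h0 fun k =>
      (((((hm 1 (hm 0 (hv x) (hv y)) (hv z) k).add (hm 1 (hm 0 (hv y) (hv z)) (hv x) k)).add
        (hm 1 (hm 0 (hv z) (hv x)) (hv y) k)).add (hm 0 (hm 1 (hv x) (hv y)) (hv z) k)).add
        (hm 0 (hm 1 (hv y) (hv z)) (hv x) k)).add (hm 0 (hm 1 (hv z) (hv x)) (hv y) k)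
  have h4 : IsClosed {c : PairSpace 4 | ∀ s t u x y z w,
      mul c s x (mul c t y (mul c u z w)) = 0} := by
    simp only [Set.ofPred_forall]
    exact isClosed_iInter fun s => isClosed_iInter fun t => isClosed_iInter fun u =>
      isClosed_iInter fun x => isClosed_iInter fun y => isClosed_iInter fun z =>
        isClosed_iInter fun w => h0 (hm s (hv x) (hm t (hv y) (hm u (hv z) (hv w))))
  have h5 : IsClosed {c : PairSpace 4 | ∀ s t u x y z w,
      mul c s (mul c t x y) (mul c u z w) = 0} := by
    simp only [Set.ofPred_forall]
    exact isClosed_iInter fun s => isClosed_iInter fun t => isClosed_iInter fun u =>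
      isClosed_iInter fun x => isClosed_iInter fun y => isClosed_iInter fun z =>
        isClosed_iInter fun w => h0 (hm s (hm t (hv x) (hv y)) (hm u (hv z) (hv w)))
  convert! ((h1 0).inter (h1 1)).inter (((h2 0).inter (h2 1)).inter (h3.inter (h4.inter h5)))
    using 1
  ext c
  exact ⟨fun ⟨⟨a, b, d, e, f⟩, p, q⟩ => ⟨⟨a, b⟩, ⟨d, e⟩, f, p, q⟩,
    fun ⟨⟨a, b⟩, ⟨d, e⟩, f, p, q⟩ => ⟨⟨a, b, d, e, f⟩, p, q⟩⟩

/-! ### Adapted bases -/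

/-- A basis `g e₁, …, g e₄` puts a pair of anticommutative multiplications in normal form as soon as
all products lie in the plane spanned by the last two vectors, all products with the third vector
lie on the line spanned by the last one, and the last one annihilates everything. -/
theorem exists_normalPair_mem_orbit {c : PairSpace 4} (g : (Fin 4 → ℂ) ≃ₗ[ℂ] (Fin 4 → ℂ))
    (halt : ∀ s x, mul c s x x = 0)
    (h₁ : ∀ s x y, mul c s x y ∈
      Submodule.span ℂ {g (Pi.single 2 1), g (Pi.single 3 1)})
    (h₂ : ∀ s x, mul c s x (g (Pi.single 2 1)) ∈ Submodule.span ℂ {g (Pi.single 3 1)})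
    (h₃ : ∀ s x, mul c s x (g (Pi.single 3 1)) = 0) :
    ∃ m : Params, ∀ s x y, mul c s (g x) (g y) = g (mul (normalPair m) s x y) := by
  have hskew := mul_skew halt
  simp only [Submodule.mem_span_pair, Submodule.mem_span_singleton] at h₁ h₂
  choose a b hab using fun s => h₁ s (g (Pi.single 0 1)) (g (Pi.single 1 1))
  choose p hp using fun s => h₂ s (g (Pi.single 0 1))
  choose q hq using fun s => h₂ s (g (Pi.single 1 1))
  obtain ⟨m, hm₀, hm₁, hm₂, hm₃⟩ : ∃ m : Params, (∀ s, m (s, 0) = a s) ∧ (∀ s, m (s, 1) = b s) ∧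
      (∀ s, m (s, 2) = p s) ∧ ∀ s, m (s, 3) = q s :=
    ⟨fun t => ![a t.1, b t.1, p t.1, q t.1] t.2, fun _ => rfl, fun _ => rfl, fun _ => rfl,
      fun _ => rfl⟩
  refine ⟨m, fun s x y => ?_⟩
  have key : (mul c s).compl₁₂ g.toLinearMap g.toLinearMap =
      (mul (normalPair m) s).compr₂ g.toLinearMap := by
    refine LinearMap.pi_ext' fun i => LinearMap.ext_ring (LinearMap.pi_ext' fun j =>
      LinearMap.ext_ring ?_)
    simp only [LinearMap.comp_apply, LinearMap.coe_single, LinearMap.compr₂_apply,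
      LinearMap.compl₁₂_apply, LinearEquiv.coe_coe]
    rw [mul_normalPair_eq_smul, map_add, map_smul, map_smul]
    set v : Fin 4 → (Fin 4 → ℂ) := fun i => g (Pi.single i 1) with hv
    have hv' : ∀ i, g (Pi.single i 1) = v i := fun i => rfl
    simp only [hv'] at hab hp hq h₃ ⊢
    have hl : ∀ x, mul c s (v 3) x = 0 := fun x => by rw [hskew, h₃, neg_zero]
    fin_cases i <;> fin_cases j <;>
      simp [halt, h₃, hl, hm₀, hm₁, hm₂, hm₃, ← hab, ← hp, ← hq, hskew _ (v 1) (v 0),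
        hskew _ (v 2) (v 0), hskew _ (v 2) (v 1), add_comm]
  exact LinearMap.congr_fun₂ key x y

/-- Every nilpotent compatible Lie algebra of dimension four has a basis in which it is in normal
form: a basis adapted to a chain of subspaces `F₁ ⊃ F₂ ⊃ F₃ ⊃ 0`, each of which is a hyperplane in
the preceding one and contains all products with a factor in the preceding one. -/
theorem exists_mem_orbit_normalPair {c : PairSpace 4} (hc : c ∈ nilpotentVariety 4) :
    ∃ m : Params, c ∈ orbit (normalPair m) := by
  obtain ⟨hlie, hnil⟩ := hc
  have halt := mul_self_eq_zero_of_isCompatibleLie hlie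
  have hne : ∀ {S : Submodule ℂ (Fin 4 → ℂ)} {k : ℕ}, Module.finrank ℂ S = k + 1 → S ≠ ⊥ := by
    rintro S k h rfl
    simp at h
  obtain ⟨v₀, F₁, hs₀, hd₀, hm₀⟩ := exists_hyperplane (μ := mul c) hnil top_ne_bot
    fun _ _ _ _ => trivial
  rw [finrank_top, Module.finrank_fin_fun] at hd₀
  obtain ⟨v₁, F₂, hs₁, hd₁, hm₁⟩ := exists_hyperplane (μ := mul c) (S := F₁) hnil
    (hne (k := 2) (by omega)) fun s x y _ => hm₀ s x y trivial
  obtain ⟨v₂, F₃, hs₂, hd₂, hm₂⟩ := exists_hyperplane (μ := mul c) (S := F₂) hnil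
    (hne (k := 1) (by omega)) fun s x y hy => hm₁ s x y (hs₁ ▸ Submodule.mem_sup_right hy)
  obtain ⟨v₃, F₄, hs₃, hd₃, hm₃⟩ := exists_hyperplane (μ := mul c) (S := F₃) hnil
    (hne (k := 0) (by omega)) fun s x y hy => hm₂ s x y (hs₂ ▸ Submodule.mem_sup_right hy)
  have hF₄ : F₄ = ⊥ := Submodule.finrank_eq_zero.1 (by omega)
  rw [hF₄, sup_bot_eq] at hs₃
  have hF₂ : F₂ = Submodule.span ℂ {v₂, v₃} := by
    rw [hs₂, hs₃, Submodule.span_insert]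
  have hspan : ⊤ ≤ Submodule.span ℂ (Set.range ![v₀, v₁, v₂, v₃]) := by
    rw [hs₀, hs₁, hF₂, ← Submodule.span_insert, ← Submodule.span_union]
    refine Submodule.span_mono ?_
    rintro x (rfl | rfl | rfl | rfl)
    exacts [⟨0, rfl⟩, ⟨1, rfl⟩, ⟨2, rfl⟩, ⟨3, rfl⟩]
  set b := basisOfTopLeSpanOfCardEqFinrank ![v₀, v₁, v₂, v₃] hspan (by simp) with hb
  set g : (Fin 4 → ℂ) ≃ₗ[ℂ] (Fin 4 → ℂ) := (Pi.basisFun ℂ (Fin 4)).equiv b (Equiv.refl _) with hg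
  have hgi : ∀ i, g (Pi.single i 1) = ![v₀, v₁, v₂, v₃] i := fun i => by
    rw [← Pi.basisFun_apply ℂ, hg, Module.Basis.equiv_apply, hb,
      coe_basisOfTopLeSpanOfCardEqFinrank]
    rfl
  have hg₂ : g (Pi.single 2 1) = v₂ := hgi 2
  have hg₃ : g (Pi.single 3 1) = v₃ := hgi 3
  have hv₂ : v₂ ∈ F₂ := hs₂ ▸ Submodule.mem_sup_left (Submodule.mem_span_singleton_self v₂)
  have hv₃ : v₃ ∈ F₃ := hs₃ ▸ Submodule.mem_span_singleton_self v₃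
  obtain ⟨m, hm⟩ := exists_normalPair_mem_orbit g halt
    (by
      rw [hg₂, hg₃, ← hF₂]
      intro s x y
      have hx : x ∈ Submodule.span ℂ {v₀} ⊔ F₁ := hs₀ ▸ trivial
      have hy : y ∈ Submodule.span ℂ {v₀} ⊔ F₁ := hs₀ ▸ trivial
      obtain ⟨a, ha, x', hx', rfl⟩ := Submodule.mem_sup.1 hx
      obtain ⟨b, hb, y', hy', rfl⟩ := Submodule.mem_sup.1 hy
      obtain ⟨a, rfl⟩ := Submodule.mem_span_singleton.1 ha
      obtain ⟨b, rfl⟩ := Submodule.mem_span_singleton.1 hb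
      rw [map_add, LinearMap.map_add₂, map_smul, LinearMap.map_smul₂, halt, smul_zero, smul_zero,
        zero_add, mul_skew halt s x']
      exact F₂.add_mem (F₂.neg_mem (hm₁ _ _ _ hx')) (hm₁ _ _ _ hy'))
    (by
      rw [hg₂, hg₃, ← hs₃]
      exact fun s x => hm₂ s x _ hv₂)
    (by
      rw [hg₃]
      exact fun s x => by simpa [hF₄] using hm₃ s x _ hv₃)
  exact ⟨m, mem_orbit_iff.2 ⟨g, hm⟩⟩

theorem normalPair_mem_nilpotentVariety (m : Params) : normalPair m ∈ nilpotentVariety 4 :=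
  (satisfiesIdentities_normalPair m).mem_nilpotentVariety

theorem mem_nilpotentVariety_iff_satisfiesIdentities {c : PairSpace 4} :
    c ∈ nilpotentVariety 4 ↔ SatisfiesIdentities c := by
  refine ⟨fun h => ?_, fun h => h.mem_nilpotentVariety⟩
  obtain ⟨m, hm⟩ := exists_mem_orbit_normalPair h
  exact (satisfiesIdentities_normalPair m).of_mem_orbit hm

theorem orbit_normalPair_subset (m : Params) : orbit (normalPair m) ⊆ nilpotentVariety 4 :=
  fun _ h => ((satisfiesIdentities_normalPair m).of_mem_orbit h).mem_nilpotentVariety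

theorem isClosed_nilpotentVariety : IsClosed (nilpotentVariety 4) := by
  convert! isClosed_setOf_satisfiesIdentities using 1
  ext c
  exact mem_nilpotentVariety_iff_satisfiesIdentities

/-! ### Parametrization by matrices and normal forms -/

theorem isPoly_det {τ : Type} {n : ℕ} {A : ZariskiSpace τ → Matrix (Fin n) (Fin n) ℂ}
    (hA : ∀ i j, IsPoly fun p => A p i j) : IsPoly fun p => (A p).det := by
  simp only [det_apply']
  exact .sum _ fun e _ => (IsPoly.const _).mul (.prod _ fun i _ => hA _ _)

theorem isPoly_adjugate {τ : Type} {n : ℕ} {A : ZariskiSpace τ → Matrix (Fin n) (Fin n) ℂ}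
    (hA : ∀ i j, IsPoly fun p => A p i j) (i j : Fin n) : IsPoly fun p => (A p).adjugate i j := by
  simp only [adjugate_apply]
  refine isPoly_det fun k l => ?_
  by_cases h : k = j
  · subst h
    simpa using IsPoly.const _
  · simpa [updateRow_ne h] using hA k l

theorem isPoly_conj {τ : Type} {n : ℕ} {X Y : ZariskiSpace τ → Matrix (Fin n) (Fin n) ℂ}
    {c : ZariskiSpace τ → PairSpace n} (hX : ∀ i j, IsPoly fun p => X p i j)
    (hY : ∀ i j, IsPoly fun p => Y p i j) (hc : ∀ t, IsPoly fun p => c p t)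
    (t : Fin 2 × Fin n × Fin n × Fin n) : IsPoly fun p => conj (X p) (Y p) (c p) t :=
  IsPoly.sum Finset.univ fun k _ => (hX _ k).mul
    (isPoly_mul hc (fun l => hY l _) (fun l => hY l _) t.1 k)

theorem isPoly_normalPair {τ : Type} {m : ZariskiSpace τ → Params}
    (hm : ∀ i, IsPoly fun p => m p i) (t : Fin 2 × Fin 4 × Fin 4 × Fin 4) :
    IsPoly fun p => normalPair (m p) t := by
  have hterm : ∀ s i j k a, IsPoly fun p => term s i j k (m p a) t := by
    intro s i j k a
    simp only [term]
    split_ifs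
    exacts [hm a, (hm a).neg, .const 0]
  exact ((((hterm _ _ _ _ _).add (hterm _ _ _ _ _)).add (hterm _ _ _ _ _)).add
    (hterm _ _ _ _ _)).add ((((hterm _ _ _ _ _).add (hterm _ _ _ _ _)).add
    (hterm _ _ _ _ _)).add (hterm _ _ _ _ _))

/-- The affine space of pairs consisting of a `4 × 4` matrix and the parameters of a pair in normal
form. -/
abbrev MatrixParams : Type := ZariskiSpace ((Fin 4 × Fin 4) ⊕ (Fin 2 × Fin 4))

/-- The matrix part of a point of `MatrixParams`. -/
def MatrixParams.matrix (p : MatrixParams) : Matrix (Fin 4) (Fin 4) ℂ :=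
  of fun i j => p (.inl (i, j))

/-- The normal form part of a point of `MatrixParams`. -/
def MatrixParams.params (p : MatrixParams) : Params := fun t => p (.inr t)

/-- The map that sends `(X, m)` to the pair with multiplications `X μ(adj(X) x, adj(X) y)`, where
`μ` is the pair in normal form with parameters `m`. The adjugate replaces `X⁻¹` to make the map
polynomial; this only rescales `m`. -/
def orbitMap (p : MatrixParams) : PairSpace 4 :=
  conj p.matrix p.matrix.adjugate (normalPair p.params)

theorem isPoly_matrix (i j : Fin 4) : IsPoly fun p : MatrixParams => p.matrix i j := .coord _

theorem continuous_orbitMap : Continuous orbitMap :=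
  continuous_of_isPoly (isPoly_conj isPoly_matrix (isPoly_adjugate isPoly_matrix)
    (isPoly_normalPair fun _ => .coord _))

theorem exists_matrixParams (X : Matrix (Fin 4) (Fin 4) ℂ) (m : Params) :
    ∃ p : MatrixParams, p.matrix = X ∧ p.params = m :=
  ⟨Sum.elim (fun t => X t.1 t.2) m, rfl, rfl⟩

/-- The parameters `a m`. -/
def scaleParams (a : ℂ) (m : Params) : Params := fun t => a * m t

theorem scaleParams_apply (a : ℂ) (m : Params) (t : Fin 2 × Fin 4) :
    scaleParams a m t = a * m t := rfl

theorem mul_normalPair_smul (m : Params) (d : ℂ) (s : Fin 2) (x y : Fin 4 → ℂ) :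
    mul (normalPair m) s (d • x) (d • y) = mul (normalPair (scaleParams (d ^ 2) m)) s x y := by
  simp only [mul_normalPair, scaleParams_apply]
  funext k
  fin_cases k <;> simp [-mul_eq_mul_left_iff, -mul_eq_mul_right_iff] <;> ring

theorem conj_adjugate_normalPair {X : Matrix (Fin 4) (Fin 4) ℂ} (hX : X.det ≠ 0) (m : Params) :
    conj X X.adjugate (normalPair m) = conj X X⁻¹ (normalPair (scaleParams (X.det ^ 2) m)) := by
  refine eq_of_mul_eq fun s x y => ?_
  have hadj : X.adjugate = X.det • X⁻¹ := by
    rw [inv_def, smul_smul, Ring.mul_inverse_cancel _ (isUnit_iff_ne_zero.2 hX), one_smul]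
  simp only [mul_conj, hadj, smul_mulVec, mul_normalPair_smul]

theorem orbitMap_mem_orbit {p : MatrixParams} (hp : p.matrix.det ≠ 0) :
    orbitMap p ∈ orbit (normalPair (scaleParams (p.matrix.det ^ 2) p.params)) := by
  rw [orbitMap, conj_adjugate_normalPair hp]
  exact conj_mem_orbit (mul_nonsing_inv _ (isUnit_iff_ne_zero.2 hp)) _

theorem image_orbitMap : orbitMap '' {p | p.matrix.det ≠ 0} = nilpotentVariety 4 := by
  apply Set.Subset.antisymm
  · rintro _ ⟨p, hp, rfl⟩
    exact orbit_normalPair_subset _ (orbitMap_mem_orbit hp)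
  · intro c hc
    obtain ⟨m, hm⟩ := exists_mem_orbit_normalPair hc
    obtain ⟨g, hg⟩ := hm
    set X : Matrix (Fin 4) (Fin 4) ℂ := LinearMap.toMatrix' g.toLinearMap with hX
    set Y : Matrix (Fin 4) (Fin 4) ℂ := LinearMap.toMatrix' g.symm.toLinearMap with hY
    have hXY : X * Y = 1 := by
      rw [hX, hY, ← LinearMap.toMatrix'_comp]
      simp
    have hdet : X.det ≠ 0 := fun h => by
      have := congrArg det hXY
      simp [h] at this
    obtain ⟨p, hpX, hpm⟩ := exists_matrixParams X (scaleParams (X.det ^ 2)⁻¹ m)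
    refine ⟨p, by rwa [Set.mem_ofPred_eq, hpX], eq_of_mul_eq fun s x y => ?_⟩
    have hm' : scaleParams (X.det ^ 2) (scaleParams (X.det ^ 2)⁻¹ m) = m :=
      funext fun t => mul_inv_cancel_left₀ (pow_ne_zero 2 hdet) _
    rw [orbitMap, hpX, hpm, conj_adjugate_normalPair hdet, inv_eq_right_inv hXY, mul_conj, hg, hm']
    have hXv : ∀ v, X *ᵥ v = g v := fun v => by
      rw [hX, LinearMap.toMatrix'_mulVec]; rfl
    have hYv : ∀ v, Y *ᵥ v = g.symm v := fun v => by
      rw [hY, LinearMap.toMatrix'_mulVec]; rfl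
    rw [hXv, hYv, hYv]

theorem isIrreducible_nilpotentVariety : IsIrreducible (nilpotentVariety 4) := by
  rw [← image_orbitMap]
  refine IsIrreducible.image ⟨?_, ?_⟩ _ continuous_orbitMap.continuousOn
  · obtain ⟨p, hp, -⟩ := exists_matrixParams 1 0
    exact ⟨p, by simp [hp]⟩
  · exact (PreirreducibleSpace.isPreirreducible_univ).open_subset (isPoly_det isPoly_matrix).isOpen
      (Set.subset_univ _)

/-- The pairs `orbitMap p` with `p` in a nonempty open set are dense in the variety. -/
theorem nilpotentVariety_subset_closure {U : Set MatrixParams} (hU : IsOpen U) (hne : U.Nonempty) :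
    nilpotentVariety 4 ⊆ closure (orbitMap '' U) := by
  rw [← image_orbitMap]
  exact (Set.image_mono ((Set.subset_univ _).trans (hU.dense hne).closure_eq.ge)).trans
    (image_closure_subset_closure_image continuous_orbitMap)

/-! ### The family `L10` -/

theorem mem_orbit_of_matrix {n : ℕ} {c d : PairSpace n} {X : Matrix (Fin n) (Fin n) ℂ}
    (hX : X.det ≠ 0) (h : ∀ s x y, mul d s (X *ᵥ x) (X *ᵥ y) = X *ᵥ mul c s x y) :
    d ∈ orbit c := by
  have hu : IsUnit X.det := isUnit_iff_ne_zero.2 hX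
  exact mem_orbit_iff.2 ⟨toLin'OfInv (nonsing_inv_mul _ hu) (mul_nonsing_inv _ hu), h⟩

/-- The parameters with the four coefficients `v` for `[-,-]` and `w` for `{-,-}`. -/
def mkParams (v w : Fin 4 → ℂ) : Params := fun t => ![v, w] t.1 t.2

theorem mkParams_zero (v w : Fin 4 → ℂ) (i : Fin 4) : mkParams v w (0, i) = v i := rfl

theorem mkParams_one (v w : Fin 4 → ℂ) (i : Fin 4) : mkParams v w (1, i) = w i := rfl

theorem L10_eq_normalPair (α : ℂ) : L10 α = normalPair (mkParams ![1, 0, 0, 1] ![α, 0, 1, 0]) := by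
  simp [L10, normalPair, mkParams_zero, mkParams_one, term_zero, add_assoc]

theorem otherAlgebras_subset : otherAlgebras ⊆ nilpotentVariety 4 := by
  have key : ∀ {A} (v w : Fin 4 → ℂ), A = normalPair (mkParams v w) → A ∈ nilpotentVariety 4 :=
    fun v w h => h ▸ normalPair_mem_nilpotentVariety _
  rintro A ((((((rfl | rfl | rfl | rfl | rfl) | ⟨α, rfl⟩) | ⟨α, rfl⟩) | ⟨α, rfl⟩) | ⟨α, β, rfl⟩))
  · exact key ![0, 0, 0, 0] ![1, 0, 0, 0]
      (by simp [L01, normalPair, mkParams_zero, mkParams_one, term_zero])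
  · exact key ![0, 0, 0, 1] ![0, 0, 1, 0]
      (by simp [L03, normalPair, mkParams_zero, mkParams_one, term_zero])
  · exact key ![1, 0, 0, 1] ![0, 1, 0, 0]
      (by simp [L04, normalPair, mkParams_zero, mkParams_one, term_zero])
  · exact key ![0, 0, 1, 0] ![1, 0, 0, 1]
      (by simp [L06, normalPair, mkParams_zero, mkParams_one, term_zero, add_assoc])
  · exact key ![0, 1, 0, 0] ![1, 0, 0, 1]
      (by simp [L07, normalPair, mkParams_zero, mkParams_one, term_zero, add_assoc])
  · exact key ![1, 0, 0, 0] ![α, 0, 0, 0]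
      (by simp [L02, normalPair, mkParams_zero, mkParams_one, term_zero])
  · exact key ![0, 0, 0, α] ![1, 0, 0, 1]
      (by simp [L05, normalPair, mkParams_zero, mkParams_one, term_zero, add_assoc])
  · exact key ![1, 0, 0, 0] ![α, 0, 0, 1]
      (by simp [L08, normalPair, mkParams_zero, mkParams_one, term_zero, add_assoc])
  · exact key ![1, 0, 0, 1] ![α, 0, 0, β]
      (by simp [L09, normalPair, mkParams_zero, mkParams_one, term_zero, add_assoc])

/-- A pair in normal form is isomorphic to a member of the family `L10` as soon as the coefficient
of `e₃` in `[e₁,e₂]` is nonzero and the functionals `[-,e₃]` and `{-,e₃}` are independent. -/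
theorem normalPair_mem_orbit_L10 {m : Params} (ha : m (0, 0) ≠ 0)
    (hΔ : m (0, 2) * m (1, 3) - m (1, 2) * m (0, 3) ≠ 0) :
    normalPair m ∈ orbit (L10 (m (1, 0) / m (0, 0))) := by
  set a := m (0, 0) with ha'
  set b := m (0, 1) with hb
  set Δ := m (0, 2) * m (1, 3) - m (1, 2) * m (0, 3) with hΔ'
  -- The first two columns are chosen so that `[u₁,e₃] = 0` and `{u₂,e₃} = 0`, and the coefficient
  -- of `e₃` in `u₂` so that `{u₁,u₂}` is a multiple of `[u₁,u₂]`; then `u₃ = [u₁,u₂]` and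
  -- `u₄ = [u₂,u₃]`.
  refine mem_orbit_of_matrix (X := !![-m (0, 3), m (1, 3), 0, 0; m (0, 2), -m (1, 2), 0, 0;
    0, m (1, 1) - m (1, 0) / a * b, -(a * Δ), 0; 0, 0, -(b * Δ), -(a * Δ ^ 2)]) ?_ ?_
  · have : (!![-m (0, 3), m (1, 3), 0, 0; m (0, 2), -m (1, 2), 0, 0;
        0, m (1, 1) - m (1, 0) / a * b, -(a * Δ), 0; 0, 0, -(b * Δ), -(a * Δ ^ 2)] :
        Matrix (Fin 4) (Fin 4) ℂ).det = -(a ^ 2 * Δ ^ 4) := by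
      simp [det_succ_row_zero, Fin.sum_univ_succ, Fin.succAbove]
      rw [hΔ']
      ring
    rw [this]
    exact neg_ne_zero.2 (mul_ne_zero (pow_ne_zero 2 ha) (pow_ne_zero 4 hΔ))
  · intro s x y
    rw [L10_eq_normalPair, mul_normalPair, mul_normalPair]
    funext k
    fin_cases s <;> fin_cases k <;>
      simp [mkParams_zero, mkParams_one, mulVec, dotProduct, Fin.sum_univ_four, ← ha', ← hb,
        -mul_eq_mul_left_iff, -mul_eq_mul_right_iff, -mul_eq_zero] <;> field_simp <;>
      rw [hΔ'] <;> ring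

theorem orbit_L10_subset (α : ℂ) : orbit (L10 α) ⊆ nilpotentVariety 4 := by
  rw [L10_eq_normalPair]
  exact orbit_normalPair_subset _

theorem nilpotentVariety_eq_familyOrbitClosure :
    nilpotentVariety 4 = familyOrbitClosure L10 := by
  refine Set.Subset.antisymm ?_
    (closure_minimal (Set.iUnion_subset orbit_L10_subset) isClosed_nilpotentVariety)
  have hdet := isPoly_det isPoly_matrix
  have hm : ∀ t, IsPoly fun p : MatrixParams => p.params t := fun t => .coord _
  refine (nilpotentVariety_subset_closure (U := {p | p.matrix.det ≠ 0} ∩ {p | p.params (0, 0) ≠ 0} ∩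
    {p | p.params (0, 2) * p.params (1, 3) - p.params (1, 2) * p.params (0, 3) ≠ 0})
    ((hdet.isOpen.inter (hm _).isOpen).inter (((hm _).mul (hm _)).sub ((hm _).mul (hm _))).isOpen)
    ?_).trans (closure_mono ?_)
  · obtain ⟨p, hp, hpm⟩ := exists_matrixParams 1 (mkParams ![1, 0, 0, 1] ![0, 0, 1, 0])
    exact ⟨p, by simp [hp, hpm, mkParams_zero, mkParams_one]⟩
  · rintro _ ⟨p, ⟨⟨hp, ha⟩, hΔ⟩, rfl⟩
    have hp2 : p.matrix.det ^ 2 ≠ 0 := pow_ne_zero 2 hp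
    refine Set.mem_iUnion.2 ⟨_, orbit_trans (normalPair_mem_orbit_L10 ?_ ?_)
      (orbitMap_mem_orbit hp)⟩
    · exact mul_ne_zero hp2 ha
    · simp only [scaleParams_apply]
      convert! mul_ne_zero (mul_ne_zero hp2 hp2) hΔ using 1
      ring

end CompatLie

namespace CompatLie

open Matrix MvPolynomial

/-! ### The dimension -/

/-- The affine space of the pairs `(u, m)`, where the five coordinates `u` determine a flag `U ⊂ W`
of a line in a plane, and `m` is the parameters of a pair in normal form. -/
abbrev FlagParams : Type := ZariskiSpace (Fin 5 ⊕ (Fin 2 × Fin 4))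

/-- The normal form part of a point of `FlagParams`. -/
def FlagParams.params (p : FlagParams) : Params := fun t => p (.inr t)

/-- The point `(u, m)` of `FlagParams`. -/
def flagPoint (u : Fin 5 → ℂ) (m : Params) : FlagParams := Sum.elim u m

theorem flagPoint_inl (u : Fin 5 → ℂ) (m : Params) (i : Fin 5) : flagPoint u m (.inl i) = u i := rfl

/-- The matrix whose last two columns `f₃ = (u₀, u₁, 1, 0)` and `f₄ = (u₂, u₃, u₄, 1)` span the flag
with coordinates `u`. -/
def flagMatrix (p : FlagParams) : Matrix (Fin 4) (Fin 4) ℂ :=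
  !![1, 0, p (.inl 0), p (.inl 2); 0, 1, p (.inl 1), p (.inl 3); 0, 0, 1, p (.inl 4); 0, 0, 0, 1]

/-- The inverse of `flagMatrix p`. -/
def flagMatrixInv (p : FlagParams) : Matrix (Fin 4) (Fin 4) ℂ :=
  !![1, 0, -p (.inl 0), p (.inl 0) * p (.inl 4) - p (.inl 2);
    0, 1, -p (.inl 1), p (.inl 1) * p (.inl 4) - p (.inl 3); 0, 0, 1, -p (.inl 4); 0, 0, 0, 1]

theorem flagMatrix_mul_flagMatrixInv (p : FlagParams) : flagMatrix p * flagMatrixInv p = 1 := by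
  ext i j
  fin_cases i <;> fin_cases j <;>
    simp [flagMatrix, flagMatrixInv, Matrix.mul_apply, Fin.sum_univ_four] <;> ring

/-- The map that sends `(u, m)` to the pair that is in normal form with parameters `m` in the basis
`e₁, e₂, f₃, f₄`, where `f₃` and `f₄` are given by `u`. -/
def flagMap (p : FlagParams) : PairSpace 4 :=
  conj (flagMatrix p) (flagMatrixInv p) (normalPair p.params)

theorem isPoly_flagMatrix (i j : Fin 4) : IsPoly fun p => flagMatrix p i j := by
  fin_cases i <;> fin_cases j <;> first | exact .const _ | exact .coord _

theorem isPoly_flagMatrixInv (i j : Fin 4) : IsPoly fun p => flagMatrixInv p i j := by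
  fin_cases i <;> fin_cases j <;>
    first
    | exact .const _
    | exact (IsPoly.coord _).neg
    | exact ((IsPoly.coord _).mul (.coord _)).sub (.coord _)

theorem isPoly_flagMap (t : Fin 2 × Fin 4 × Fin 4 × Fin 4) : IsPoly fun p => flagMap p t :=
  isPoly_conj isPoly_flagMatrix isPoly_flagMatrixInv (isPoly_normalPair fun _ => .coord _) t

theorem flagMap_mem_nilpotentVariety (p : FlagParams) : flagMap p ∈ nilpotentVariety 4 :=
  orbit_normalPair_subset _ (conj_mem_orbit (flagMatrix_mul_flagMatrixInv p) _)

/-- If `c` is in normal form in the basis formed by the columns of `X`, and the flag spanned by the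
last two columns lies in the chart given by `flagMatrix`, then `c` is a value of `flagMap`: the
normal form persists in the basis `e₁, e₂, f₃, f₄`, as it only depends on the flag. -/
theorem mem_range_flagMap {c : PairSpace 4} {m : Params} {X : Matrix (Fin 4) (Fin 4) ℂ}
    (h : ∀ s x y, mul c s (X *ᵥ x) (X *ᵥ y) = X *ᵥ mul (normalPair m) s x y)
    (hX : X.det ≠ 0) (h₁ : X 3 3 ≠ 0) (h₂ : X 2 2 * X 3 3 - X 2 3 * X 3 2 ≠ 0) :
    c ∈ Set.range flagMap := by
  have halt : ∀ s x, mul c s x x = 0 := by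
    have hc : c ∈ orbit (normalPair m) := mem_orbit_of_matrix hX h
    exact mul_self_eq_zero_of_isCompatibleLie (orbit_normalPair_subset m hc).1
  have hsurj : ∀ x, ∃ x', X *ᵥ x' = x := fun x => ⟨X⁻¹ *ᵥ x, by
    rw [mulVec_mulVec, mul_nonsing_inv _ (isUnit_iff_ne_zero.2 hX), one_mulVec]⟩
  set D := X 2 2 * X 3 3 - X 2 3 * X 3 2 with hD
  -- The combinations `f₃ = α v₃ + β v₄` and `f₄ = λ⁻¹ v₄` of the last two columns `v₃`, `v₄` of `X`
  -- whose last two coordinates are `(1, 0)` and `(∗, 1)`.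
  set α := X 3 3 / D with hα
  set β := -X 3 2 / D with hβ
  have hα0 : α ≠ 0 := div_ne_zero h₁ h₂
  set u : Fin 5 → ℂ := ![α * X 0 2 + β * X 0 3, α * X 1 2 + β * X 1 3, (X 3 3)⁻¹ * X 0 3,
    (X 3 3)⁻¹ * X 1 3, (X 3 3)⁻¹ * X 2 3] with hu
  set H : Params → Matrix (Fin 4) (Fin 4) ℂ := fun m' => flagMatrix (flagPoint u m') with hH
  have hf₃ : H 0 *ᵥ Pi.single 2 1 = X *ᵥ (α • Pi.single 2 1 + β • Pi.single 3 1) := by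
    rw [mulVec_add, mulVec_smul, mulVec_smul, mulVec_single_one, mulVec_single_one,
      mulVec_single_one]
    funext k
    fin_cases k <;> simp [hH, flagMatrix, flagPoint_inl, hu]
    · rw [hα, hβ, div_mul_eq_mul_div, div_mul_eq_mul_div, ← add_div, eq_div_iff h₂, hD]
      ring
    · rw [hα, hβ]
      ring
  have hf₄ : H 0 *ᵥ Pi.single 3 1 = X *ᵥ ((X 3 3)⁻¹ • Pi.single 3 1) := by
    rw [mulVec_smul, mulVec_single_one, mulVec_single_one]
    funext k
    fin_cases k <;> simp [hH, flagMatrix, flagPoint_inl, hu, h₁]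
  have hinv := flagMatrix_mul_flagMatrixInv (flagPoint u 0)
  set g := toLin'OfInv (mul_eq_one_comm.1 hinv) hinv with hg
  have hgv : ∀ v, g v = H 0 *ᵥ v := fun v => rfl
  have hv₄ : X *ᵥ Pi.single 3 1 = X 3 3 • g (Pi.single 3 1) := by
    rw [hgv, hf₄, mulVec_smul, smul_smul, mul_inv_cancel₀ h₁, one_smul]
  have hv₃ : X *ᵥ Pi.single 2 1 =
      α⁻¹ • (g (Pi.single 2 1) - β • X 3 3 • g (Pi.single 3 1)) := by
    rw [← hv₄, hgv, hf₃, mulVec_add, mulVec_smul, mulVec_smul, add_sub_cancel_right, smul_smul,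
      inv_mul_cancel₀ hα0, one_smul]
  obtain ⟨m', hm'⟩ := exists_normalPair_mem_orbit g halt
    (fun s x y => by
      obtain ⟨x, rfl⟩ := hsurj x
      obtain ⟨y, rfl⟩ := hsurj y
      rw [h, mul_normalPair_eq_smul, mulVec_add, mulVec_smul, mulVec_smul, hv₃, hv₄]
      have m₃ := Submodule.subset_span (R := ℂ)
        (Set.mem_insert (g (Pi.single 2 1)) {g (Pi.single 3 1)})
      have m₄ := Submodule.subset_span (R := ℂ) (Set.mem_insert_of_mem (g (Pi.single 2 1))
        (Set.mem_singleton (g (Pi.single 3 1))))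
      exact Submodule.add_mem _
        (Submodule.smul_mem _ _ (Submodule.smul_mem _ _ (Submodule.sub_mem _ m₃
          (Submodule.smul_mem _ _ (Submodule.smul_mem _ _ m₄)))))
        (Submodule.smul_mem _ _ (Submodule.smul_mem _ _ m₄)))
    (fun s x => by
      obtain ⟨x, rfl⟩ := hsurj x
      have hN : mul (normalPair m) s x (α • Pi.single 2 1 + β • Pi.single 3 1) =
          (m (s, 2) * (x 0 * α) + m (s, 3) * (x 1 * α)) • Pi.single 3 1 := by
        rw [mul_normalPair]
        funext k
        fin_cases k <;> simp
      rw [hgv (Pi.single 2 1), hf₃, h, hN, mulVec_smul, hv₄]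
      exact Submodule.smul_mem _ _ (Submodule.smul_mem _ _ (Submodule.mem_span_singleton_self _)))
    (fun s x => by
      obtain ⟨x, rfl⟩ := hsurj x
      rw [hgv, hf₄, h, mul_normalPair_eq_smul]
      simp)
  refine ⟨flagPoint u m', eq_of_mul_eq fun s x y => ?_⟩
  refine (mul_conj _ _ _ s x y).trans ?_
  refine (hm' s _ _).symm.trans ?_
  have hgi : ∀ v, g (flagMatrixInv (flagPoint u m') *ᵥ v) = v := fun v =>
    (mulVec_mulVec _ _ _).trans ((congrArg (· *ᵥ v) hinv).trans (one_mulVec v))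
  rw [hgi, hgi]

theorem closure_range_flagMap : closure (Set.range flagMap) = nilpotentVariety 4 := by
  refine Set.Subset.antisymm (closure_minimal
    (Set.range_subset_iff.2 flagMap_mem_nilpotentVariety) isClosed_nilpotentVariety) ?_
  have hX := isPoly_matrix
  refine (nilpotentVariety_subset_closure (U := {p | p.matrix.det ≠ 0} ∩ {p | p.matrix 3 3 ≠ 0} ∩
    {p | p.matrix 2 2 * p.matrix 3 3 - p.matrix 2 3 * p.matrix 3 2 ≠ 0})
    (((isPoly_det hX).isOpen.inter (hX _ _).isOpen).inter
      (((hX _ _).mul (hX _ _)).sub ((hX _ _).mul (hX _ _))).isOpen) ?_).trans (closure_mono ?_)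
  · obtain ⟨p, hp, -⟩ := exists_matrixParams 1 0
    exact ⟨p, by simp [hp]⟩
  · rintro _ ⟨p, ⟨⟨hp, h₁⟩, h₂⟩, rfl⟩
    have hu : IsUnit p.matrix.det := isUnit_iff_ne_zero.2 hp
    refine mem_range_flagMap (m := scaleParams (p.matrix.det ^ 2) p.params) (fun s x y => ?_)
      hp h₁ h₂
    rw [orbitMap, conj_adjugate_normalPair hp, mul_conj, mulVec_mulVec, mulVec_mulVec,
      nonsing_inv_mul _ hu, one_mulVec, one_mulVec]

theorem flagMap_apply_zero_one (p : FlagParams) (s : Fin 2) (k : Fin 4) :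
    flagMap p (s, 0, 1, k) = ![p (.inr (s, 0)) * p (.inl 0) + p (.inr (s, 1)) * p (.inl 2),
      p (.inr (s, 0)) * p (.inl 1) + p (.inr (s, 1)) * p (.inl 3),
      p (.inr (s, 0)) + p (.inr (s, 1)) * p (.inl 4), p (.inr (s, 1))] k := by
  fin_cases k <;>
    simp [flagMap, conj, mul_normalPair, flagMatrix, flagMatrixInv, mulVec, dotProduct,
      Fin.sum_univ_four, FlagParams.params] <;> ring

theorem flagMap_apply_zero_two (p : FlagParams) (s : Fin 2) (k : Fin 4) :
    flagMap p (s, 0, 2, k) = ![p (.inl 2), p (.inl 3), p (.inl 4), 1] k * p (.inr (s, 2)) -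
      p (.inl 1) * flagMap p (s, 0, 1, k) := by
  fin_cases k <;>
    simp [flagMap, conj, mul_normalPair, flagMatrix, flagMatrixInv, mulVec, dotProduct,
      Fin.sum_univ_four, FlagParams.params] <;> ring

theorem flagMap_apply_one_two (p : FlagParams) (s : Fin 2) :
    flagMap p (s, 1, 2, 3) = p (.inr (s, 3)) + p (.inl 0) * p (.inr (s, 1)) := by
  simp [flagMap, conj, mul_normalPair, flagMatrix, flagMatrixInv, mulVec, dotProduct,
    Fin.sum_univ_four, FlagParams.params]
  ring

/-- The thirteen source coordinates are algebraic over the components of `flagMap`.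
From a generic pair one recovers the plane `W` (`u₀` and `u₁`) as the span of `[e₁,e₂]` and
`{e₁,e₂}`, then the line `U` (`u₂`, `u₃` and `u₄`) from the products of `e₁` with `W`, and the remaining
parameters by subtraction. -/
theorem isAlgebraic_X {P : Fin 2 × Fin 4 × Fin 4 × Fin 4 → MvPolynomial (Fin 5 ⊕ Fin 2 × Fin 4) ℂ}
    (hP : ∀ t (x : FlagParams), aeval (x : Fin 5 ⊕ Fin 2 × Fin 4 → ℂ) (P t) = flagMap x t)
    (j : Fin 5 ⊕ Fin 2 × Fin 4) :
    IsAlgebraic (aeval P : MvPolynomial (Fin 2 × Fin 4 × Fin 4 × Fin 4) ℂ →ₐ[ℂ] _).range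
      (X j : MvPolynomial (Fin 5 ⊕ Fin 2 × Fin 4) ℂ) := by
  set A := (aeval P : MvPolynomial (Fin 2 × Fin 4 × Fin 4 × Fin 4) ℂ →ₐ[ℂ]
    MvPolynomial (Fin 5 ⊕ Fin 2 × Fin 4) ℂ).range with hA
  have halg : ∀ t, IsAlgebraic A (P t) := fun t =>
    isAlgebraic_algebraMap (⟨P t, X t, aeval_X P t⟩ : A)
  have heq : ∀ t (q : MvPolynomial (Fin 5 ⊕ Fin 2 × Fin 4) ℂ),
      (∀ x : Fin 5 ⊕ Fin 2 × Fin 4 → ℂ, flagMap x t = eval x q) →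
      P t = q := fun t q h => MvPolynomial.funext fun x => (hP t x).trans (h x)
  have hPe : ∀ t (x : Fin 5 ⊕ Fin 2 × Fin 4 → ℂ), flagMap x t = eval x (P t) := fun t x =>
    (hP t x).symm
  have hdiv : ∀ {y z : MvPolynomial (Fin 5 ⊕ Fin 2 × Fin 4) ℂ}, y ≠ 0 → IsAlgebraic A y →
      IsAlgebraic A (y * z) → IsAlgebraic A z := fun hy =>
    IsAlgebraic.of_mul (mem_nonZeroDivisors_of_ne_zero hy)
  -- `m s i` and `u i` are the coordinates as polynomials.
  set m : Fin 2 → Fin 4 → MvPolynomial (Fin 5 ⊕ Fin 2 × Fin 4) ℂ := fun s i => X (.inr (s, i))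
    with hm
  set u : Fin 5 → MvPolynomial (Fin 5 ⊕ Fin 2 × Fin 4) ℂ := fun i => X (.inl i) with hu
  have p0 : ∀ s, P (s, 0, 1, 0) = m s 0 * u 0 + m s 1 * u 2 := fun s =>
    heq _ _ fun x => (flagMap_apply_zero_one x s 0).trans (by simp [hm, hu])
  have p1 : ∀ s, P (s, 0, 1, 1) = m s 0 * u 1 + m s 1 * u 3 := fun s =>
    heq _ _ fun x => (flagMap_apply_zero_one x s 1).trans (by simp [hm, hu])
  have p2 : ∀ s, P (s, 0, 1, 2) = m s 0 + m s 1 * u 4 := fun s =>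
    heq _ _ fun x => (flagMap_apply_zero_one x s 2).trans (by simp [hm, hu])
  have p3 : ∀ s, P (s, 0, 1, 3) = m s 1 := fun s =>
    heq _ _ fun x => (flagMap_apply_zero_one x s 3).trans (by simp [hm])
  have q0 : ∀ s, P (s, 0, 2, 0) = u 2 * m s 2 - u 1 * P (s, 0, 1, 0) := fun s =>
    heq _ _ fun x => (flagMap_apply_zero_two x s 0).trans (by
      rw [map_sub, map_mul, map_mul, ← hPe]; simp [hm, hu])
  have q1 : ∀ s, P (s, 0, 2, 1) = u 3 * m s 2 - u 1 * P (s, 0, 1, 1) := fun s =>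
    heq _ _ fun x => (flagMap_apply_zero_two x s 1).trans (by
      rw [map_sub, map_mul, map_mul, ← hPe]; simp [hm, hu])
  have q2 : ∀ s, P (s, 0, 2, 2) = u 4 * m s 2 - u 1 * P (s, 0, 1, 2) := fun s =>
    heq _ _ fun x => (flagMap_apply_zero_two x s 2).trans (by
      rw [map_sub, map_mul, map_mul, ← hPe]; simp [hm, hu])
  have q3 : ∀ s, P (s, 0, 2, 3) = m s 2 - u 1 * P (s, 0, 1, 3) := fun s =>
    heq _ _ fun x => (flagMap_apply_zero_two x s 3).trans (by
      rw [map_sub, map_mul, ← hPe]; simp [hm, hu])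
  have r3 : ∀ s, P (s, 1, 2, 3) = m s 3 + u 0 * m s 1 := fun s =>
    heq _ _ fun x => (flagMap_apply_one_two x s).trans (by simp [hm, hu])
  have a1 : ∀ s, IsAlgebraic A (m s 1) := fun s => p3 s ▸ halg _
  set D := m 0 0 * m 1 1 - m 1 0 * m 0 1 with hD
  have hD0 : D ≠ 0 := fun h => by
    have := congrArg (eval (Sum.elim 0 fun t : Fin 2 × Fin 4 => if t = (0, 0) ∨ t = (1, 1) then 1
      else 0)) h
    simp [hD, hm] at this
  have aD : IsAlgebraic A D := by
    have : D = P (0, 0, 1, 2) * m 1 1 - P (1, 0, 1, 2) * m 0 1 := by rw [p2, p2, hD]; ring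
    rw [this]
    exact ((halg _).mul (a1 1)).sub ((halg _).mul (a1 0))
  have au0 : IsAlgebraic A (u 0) := hdiv hD0 aD <| by
    have : D * u 0 = P (0, 0, 1, 0) * m 1 1 - P (1, 0, 1, 0) * m 0 1 := by rw [p0, p0, hD]; ring
    rw [this]
    exact ((halg _).mul (a1 1)).sub ((halg _).mul (a1 0))
  have au1 : IsAlgebraic A (u 1) := hdiv hD0 aD <| by
    have : D * u 1 = P (0, 0, 1, 1) * m 1 1 - P (1, 0, 1, 1) * m 0 1 := by rw [p1, p1, hD]; ring
    rw [this]
    exact ((halg _).mul (a1 1)).sub ((halg _).mul (a1 0))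
  have a2 : ∀ s, IsAlgebraic A (m s 2) := fun s => by
    rw [← sub_add_cancel (m s 2) (u 1 * P (s, 0, 1, 3)), ← q3]
    exact (halg _).add (au1.mul (halg _))
  have a3 : ∀ s, IsAlgebraic A (m s 3) := fun s => by
    rw [← add_sub_cancel_right (m s 3) (u 0 * m s 1), ← r3]
    exact (halg _).sub (au0.mul (a1 s))
  have hu' : ∀ i k, P (0, 0, 2, k) = u i * m 0 2 - u 1 * P (0, 0, 1, k) → IsAlgebraic A (u i) :=
    fun i k h => hdiv (y := m 0 2) (X_ne_zero _) (a2 0) <| by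
      rw [mul_comm, ← sub_add_cancel (u i * m 0 2) (u 1 * P (0, 0, 1, k)), ← h]
      exact (halg _).add (au1.mul (halg _))
  have au4 := hu' 4 2 (q2 0)
  have a0 : ∀ s, IsAlgebraic A (m s 0) := fun s => by
    rw [← add_sub_cancel_right (m s 0) (m s 1 * u 4), ← p2]
    exact (halg _).sub ((a1 s).mul au4)
  rcases j with i | ⟨s, i⟩
  · fin_cases i
    exacts [au0, au1, hu' 2 0 (q0 0), hu' 3 1 (q1 0), au4]
  · fin_cases i
    exacts [a0 s, a1 s, a2 s, a3 s]

theorem topologicalKrullDim_nilpotentVariety :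
    topologicalKrullDim (nilpotentVariety 4) = 13 := by
  choose P hP using isPoly_flagMap
  rw [← closure_range_flagMap, topologicalKrullDim_closure_range (F := flagMap) P
    (fun x i => hP i x) (isAlgebraic_X hP)]
  simp

end CompatLie

end

theorem theorem2p6 :
    IsIrreducible (CompatLie.nilpotentVariety 4) ∧
    CompatLie.nilpotentVariety 4 = CompatLie.familyOrbitClosure CompatLie.L10 ∧
    topologicalKrullDim (CompatLie.nilpotentVariety 4) = 13 ∧
    ∀ A ∈ CompatLie.otherAlgebras, CompatLie.FamilyDegeneratesTo CompatLie.L10 A :=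
  ⟨CompatLie.isIrreducible_nilpotentVariety, CompatLie.nilpotentVariety_eq_familyOrbitClosure,
    CompatLie.topologicalKrullDim_nilpotentVariety, fun _ hA =>
      CompatLie.nilpotentVariety_eq_familyOrbitClosure.subset (CompatLie.otherAlgebras_subset hA)⟩
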